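/- Let $\mathbb{D}\subset\mathbb{R}^2$ be the open unit disc. All functions are complex-valued, $\langle f,g\rangle:=\mathrm{Re}\int_{\mathbb{D}} f\bar g\,dx$, $L^2_{rad}(\mathbb{D})$ is the space of radial functions in $L^2(\mathbb{D})$, and $H^1_{rad,0}(\mathbb{D})$ is the space of radial $H^1(\mathbb{D})$ functions with zero trace on $\partial\mathbb{D}$, with the $\dot H^1$ inner product $\mathrm{Re}\int_{\mathbb{D}}\nabla u\cdot\overline{\nabla v}\,dx$. Let $Q$ be the ground state on $\mathbb{R}^2$, that is, the smooth, positive, radial, exponentially decaying solution of $-\Delta Q+Q-Q^3=0$. For $\delta>0$ put $Q_\delta(x)=\delta^{-1}Q(\delta^{-1}x)$, $\mathbf{Q}_\delta(r)=Q_\delta(r)-Q_\delta(1)$ with $r=|x|$, and $$V_{0,\delta}:=\{v\in L^2_{rad}(\mathbb{D}):\ \langle v,-\Delta(\partial_\delta\mathbf{Q}_\delta)\rangle=\langle v,-\Delta(i\mathbf{Q}_\delta)\rangle=0\}.$$ Let $\mu_{V_{0,\delta}}$ be the free Gaussian measure on $V_{0,\delta}$: the law on $L^2(\mathbb{D})$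 of $\sum_{n} g_n h_n$ (the limit of the partial sums in $L^2(\mathbb{D})$), where $(h_n)$ is any $\dot H^1$-orthonormal basis of the real Hilbert space $V_{0,\delta}\cap H^1_{rad,0}(\mathbb{D})$ and $(g_n)$ are independent real $\mathcal{N}(0,1)$ random variables. For every constant $C_\eta>0$ there exists $\epsilon_0>0$ (independent of $\delta$ and of the basis) such that for all $0<\epsilon\le\epsilon_0$ and all $\delta>0$, $$\int_{\|v\|_{L^2(\mathbb{D})}\le\epsilon}\exp\Big(C_\eta\int_{\mathbb{D}}|v|^4\,dx\Big)\,d\mu_{V_{0,\delta}}(v)<\infty .$$ -/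

import Mathlib

open MeasureTheory ProbabilityTheory Filter Topology Laplacian
open scoped ENNReal ContDiff

namespace RadialNLS

noncomputable section

/-- The plane `ℝ²` with its Euclidean norm. -/
abbrev Plane : Type := EuclideanSpace ℝ (Fin 2)

/-- The open unit disc `𝔻`. -/
def disc : Set Plane := Metric.ball 0 1

/-- `L²(𝔻)`, complex valued.  Its real inner product is `⟪f, g⟫_ℝ = Re ∫_𝔻 f \bar g`. -/
abbrev L2Disc : Type := Lp ℂ 2 (volume.restrict disc)

instance : MeasurableSpace L2Disc := borel L2Disc

instance : BorelSpace L2Disc := ⟨rfl⟩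

/-! ### The ground state and the soliton profiles -/

/-- `Q` is the ground state on `ℝ²`: the positive, radial, exponentially decaying (classical,
smooth) solution of `-Δ Q + Q - Q³ = 0`. -/
structure IsGroundState (Q : Plane → ℝ) : Prop where
  smooth : ContDiff ℝ ∞ Q
  pos : ∀ x, 0 < Q x
  radial : ∀ x y, ‖x‖ = ‖y‖ → Q x = Q y
  decay : ∃ A c : ℝ, 0 < c ∧ ∀ x, Q x ≤ A * Real.exp (-c * ‖x‖)
  equation : ∀ x, -(Δ Q) x + Q x - Q x ^ 3 = 0

/-- The `L²`-invariant rescaling `Q_δ(x) = δ⁻¹ Q(δ⁻¹ x)`. -/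
def rescaled (Q : Plane → ℝ) (δ : ℝ) (x : Plane) : ℝ := δ⁻¹ * Q (δ⁻¹ • x)

/-- The profile `𝐐_δ(r) = Q_δ(r) - Q_δ(1)`, which vanishes on the unit circle. -/
def profile (Q : Plane → ℝ) (δ : ℝ) (x : Plane) : ℝ :=
  rescaled Q δ x - rescaled Q δ (EuclideanSpace.single 0 1)

/-- The derivative `∂_δ 𝐐_δ`. -/
def profileDeriv (Q : Plane → ℝ) (δ : ℝ) (x : Plane) : ℝ :=
  deriv (fun d => profile Q d x) δ

/-! ### Function spaces on the disc -/

/-- `L²_rad(𝔻)`: the classes in `L²(𝔻)` of functions of `|x|`. -/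
def L2rad : Set L2Disc :=
  {v | ∃ f : ℝ → ℂ, Measurable f ∧ ∀ᵐ x ∂(volume.restrict disc), v x = f ‖x‖}

/-- `v` belongs to `H¹₀(𝔻)` with weak gradient `G = (∂₁v, ∂₂v) ∈ L²(𝔻)²`.  The test functions are
not required to vanish near `∂𝔻`: those supported in `𝔻` say that `G` is the weak gradient of `v`,
and the absence of a boundary term in Green's formula for the others says that the trace of `v` on
`∂𝔻` is zero. -/
def HasGradientH10 (v : L2Disc) (G : Fin 2 → L2Disc) : Prop :=
  ∀ φ : Plane → ℝ, ContDiff ℝ ∞ φ → HasCompactSupport φ → ∀ j : Fin 2,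
    ∫ x in disc, (fderiv ℝ φ x (EuclideanSpace.single j 1)) • v x
      = -∫ x in disc, φ x • G j x

/-- `H¹_{rad,0}(𝔻)`, as a subset of `L²(𝔻)`. -/
def H10rad : Set L2Disc := {v | v ∈ L2rad ∧ ∃ G, HasGradientH10 v G}

open Classical in
/-- The weak gradient of an element of `H¹₀(𝔻)` (it is unique); zero elsewhere. -/
def gradient (v : L2Disc) : Fin 2 → L2Disc :=
  if h : ∃ G, HasGradientH10 v G then h.choose else 0

/-- The `Ḣ¹` inner product `Re ∫_𝔻 ∇u · \bar{∇v}`. -/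
def dirichletInner (u v : L2Disc) : ℝ := ∑ j : Fin 2, inner ℝ (gradient u j) (gradient v j)

/-- The normal space
`V_{0,δ} = {v ∈ L²_rad(𝔻) : ⟨v, -Δ ∂_δ𝐐_δ⟩ = ⟨v, -Δ (i 𝐐_δ)⟩ = 0}`, with
`⟨f, g⟩ = Re ∫_𝔻 f \bar g`. -/
def normalSpace (Q : Plane → ℝ) (δ : ℝ) : Set L2Disc :=
  {v | v ∈ L2rad ∧
    ∫ x in disc, inner ℝ (v x) (-(Δ (fun y => (profileDeriv Q δ y : ℂ))) x) = 0 ∧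
    ∫ x in disc, inner ℝ (v x) (-(Δ (fun y => Complex.I * (profile Q δ y : ℂ))) x) = 0}

/-! ### Free Gaussian measures -/

/-- `h` is an orthonormal basis, for the `Ḣ¹` inner product, of the real Hilbert space
`V ∩ H¹_{rad,0}(𝔻)`. -/
structure IsDirichletBasis (V : Set L2Disc) (h : ℕ → L2Disc) : Prop where
  mem : ∀ n, h n ∈ V ∩ H10rad
  orthonormal : ∀ m n, dirichletInner (h m) (h n) = if m = n then 1 else 0
  complete : ∀ v ∈ V ∩ H10rad, (∀ n, dirichletInner (h n) v = 0) → v = 0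

/-- The law of a sequence of independent real standard Gaussians. -/
def gaussianSequence : Measure (ℕ → ℝ) := Measure.infinitePi fun _ => gaussianReal 0 1

/-- The random series `∑ₙ gₙ hₙ`, as the limit in `L²(𝔻)` of its partial sums. -/
def gaussianSeries (h : ℕ → L2Disc) (g : ℕ → ℝ) : L2Disc :=
  limUnder atTop fun N : ℕ => ∑ n ∈ Finset.range N, g n • h n

/-- The law on `L²(𝔻)` of `∑ₙ gₙ hₙ`.  For an `Ḣ¹`-orthonormal basis `h` of `V ∩ H¹_{rad,0}(𝔻)`
this is the free Gaussian measure on `V`. -/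
def freeGaussian (h : ℕ → L2Disc) : Measure L2Disc := gaussianSequence.map (gaussianSeries h)

theorem measurable_gaussianSeries (h : ℕ → L2Disc) : Measurable (gaussianSeries h) := by
  have : ∀ N : ℕ, StronglyMeasurable fun g : ℕ → ℝ => ∑ n ∈ Finset.range N, g n • h n := by
    intro N
    exact Finset.stronglyMeasurable_fun_sum _ fun n _ =>
      (measurable_pi_apply n).stronglyMeasurable.smul_const (h n)
  exact (StronglyMeasurable.limUnder this).measurable

instance (h : ℕ → L2Disc) : IsProbabilityMeasure (freeGaussian h) := by
  unfold freeGaussian gaussianSequence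
  exact Measure.isProbabilityMeasure_map (measurable_gaussianSeries h).aemeasurable

/-- The quartic exponential `exp (C ∫_𝔻 |v|⁴)`, equal to `∞` when `v ∉ L⁴(𝔻)`. -/
def quarticExp (C : ℝ) (v : L2Disc) : ℝ≥0∞ :=
  EReal.exp ((ENNReal.ofReal C * ∫⁻ x in disc, ‖v x‖ₑ ^ 4 : ℝ≥0∞) : EReal)

end

end RadialNLS

/-! The engine is Maurey's property (τ) of Gaussian measure γ: if u(x)v(y) ≤ exp(|x−y|²/4) for all
x, y, then ∫u dγ · ∫v dγ ≤ 1. In the coordinates of the basis, |x−y|² is the squared Dirichlet norm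
of the difference of the two partial sums. Take u = exp(C∫|x|⁴) on the L² ball of radius 2ε, and v =
exp(−8CM) on a set E of y with ‖y‖ ≤ ε and ∫|y|⁴ ≤ M. Since ‖x−y‖ ≤ 3ε, Ladyzhenskaya's inequality
(constant K) gives ∫|x−y|⁴ ≤ 9Kε²|x−y|². As ∫|x|⁴ ≤ 8(∫|y|⁴ + ∫|x−y|⁴), the hypothesis of (τ) holds
once 72CKε² ≤ 1/4. Hence ∫u dγ ≤ exp(8CM)/γ(E), and the smallness of ε depends only on C and K,
which gives the uniformity in δ and in the basis.

It remains to bound γ(E) below uniformly in the number of modes (`exists_smallBall`). Finitely many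
low modes are confined to a small cube, which has positive probability. The independent high modes
are controlled by Markov's inequality, using the trace ∑‖hₙ‖² and the expected quartic functional.
Both rest on radial symmetry: a radial H¹₀ function satisfies |v(x)|² ≤ w(x)‖∇v‖² with w of order
|x|^(−1/2), so by duality ∑|hₙ(x)|² ≤ 2w(x), and w and w² are integrable on the disc.

The finite trace also gives almost sure convergence of the series in L², through Kolmogorov's
maximal inequality. The uniform bound passes to the limit by Fatou's lemma and lower semicontinuity
of the quartic functional under L² convergence.

Property (τ) is derived from the one-dimensional Prékopa–Leindler inequality and tensorization.
Sobolev-type estimates for H¹₀ are proved for mollifications of the extension by zero and then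
passed to the limit. -/

namespace RadialNLS

/-! ### The Prékopa–Leindler inequality on the line -/

/-- The one-dimensional Brunn–Minkowski inequality for midpoints of compact sets. -/
theorem volume_add_volume_le_of_isCompact {A B C : Set ℝ} (hA : IsCompact A) (hB : IsCompact B)
    (hA' : A.Nonempty) (hB' : B.Nonempty)
    (h : ∀ a ∈ A, ∀ b ∈ B, (a + b) / 2 ∈ C) :
    volume A + volume B ≤ 2 * volume C := by
  obtain ⟨a, ha, hamax⟩ := hA.exists_isGreatest hA'
  obtain ⟨b, hb, hbmin⟩ := hB.exists_isLeast hB'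
  -- With a = max A and b = min B, the translates A + b and B + a both lie in D = 2C and meet only
  -- at a + b, so their lengths add.
  set D : Set ℝ := (fun z : ℝ => (2⁻¹ : ℝ) * z) ⁻¹' C with hD
  have hvD : volume D = 2 * volume C := by
    rw [hD, Real.volume_preimage_mul_left (by norm_num)]
    norm_num
  have hAD : (fun z : ℝ => z + (-b)) ⁻¹' A ⊆ D := by
    intro z hz
    have := h _ hz b hb
    simp only [hD, Set.mem_preimage]
    convert this using 1
    ring
  have hBD : (fun z : ℝ => z + (-a)) ⁻¹' B ⊆ D := by
    intro z hz
    have := h a ha _ hz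
    simp only [hD, Set.mem_preimage]
    convert this using 1
    ring
  have hAIic : (fun z : ℝ => z + (-b)) ⁻¹' A ⊆ Set.Iic (a + b) := by
    intro z hz
    have := hamax hz
    simp only [Set.mem_Iic]
    linarith
  have hBIci : (fun z : ℝ => z + (-a)) ⁻¹' B ⊆ Set.Ici (a + b) := by
    intro z hz
    have := hbmin hz
    simp only [Set.mem_Ici]
    linarith
  rw [← hvD, ← measure_preimage_add_right volume (-b) A, ← measure_preimage_add_right volume (-a) B,
    ← measure_inter_add_sdiff D (measurableSet_Iio (a := a + b))]
  gcongr ?_ + ?_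
  · rw [← measure_sdiff_null (s := (fun z : ℝ => z + (-b)) ⁻¹' A)
      (measure_singleton (μ := volume) (a + b))]
    refine measure_mono fun z hz => ⟨hAD hz.1, lt_of_le_of_ne (hAIic hz.1) hz.2⟩
  · exact measure_mono fun z hz => ⟨hBD hz, fun hz' => (not_lt.2 (hBIci hz)) hz'.out⟩

/-- The one-dimensional Brunn–Minkowski inequality for midpoints. -/
theorem volume_add_volume_le {A B C : Set ℝ} (hA : MeasurableSet A) (hB : MeasurableSet B)
    (hA' : A.Nonempty) (hB' : B.Nonempty)
    (h : ∀ a ∈ A, ∀ b ∈ B, (a + b) / 2 ∈ C) :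
    volume A + volume B ≤ 2 * volume C := by
  obtain ⟨a, ha⟩ := hA'
  obtain ⟨b, hb⟩ := hB'
  have key : ∀ K ⊆ A, IsCompact K → ∀ L ⊆ B, IsCompact L →
      volume K + volume L ≤ 2 * volume C := by
    intro K hKA hK L hLB hL
    -- Adjoining a point of A and a point of B makes the compact sets nonempty, as the compact case
    -- requires.
    refine le_trans (add_le_add (measure_mono (Set.subset_insert a K))
      (measure_mono (Set.subset_insert b L))) ?_
    exact volume_add_volume_le_of_isCompact (hK.insert a) (hL.insert b)
      (Set.insert_nonempty _ _) (Set.insert_nonempty _ _) fun x hx y hy =>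
        h x (Set.insert_subset ha hKA hx) y (Set.insert_subset hb hLB hy)
  have hsup : ∀ S : Set ℝ, MeasurableSet S →
      volume S = ⨆ K, ⨆ _ : K ⊆ S ∧ IsCompact K, volume K := by
    intro S hS
    simp_rw [iSup_and]
    exact hS.measure_eq_iSup_isCompact volume
  rw [hsup A hA, hsup B hB]
  exact ENNReal.biSup_add_biSup_le' ⟨∅, Set.empty_subset _, isCompact_empty⟩
    ⟨∅, Set.empty_subset _, isCompact_empty⟩ fun K hK L hL => key K hK.1 hK.2 L hL.1 hL.2

/-- Additive form of the Prékopa–Leindler inequality for functions of supremum one. -/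
theorem lintegral_add_lintegral_le {f g w : ℝ → ℝ} (hf : Measurable f) (hg : Measurable g)
    (hw : Measurable w) (hf0 : 0 ≤ f) (hg0 : 0 ≤ g) (hw0 : 0 ≤ w) (hf1 : f ≤ 1) (hg1 : g ≤ 1)
    (hfs : ∀ t, 0 < t → t < 1 → ∃ x, t < f x) (hgs : ∀ t, 0 < t → t < 1 → ∃ x, t < g x)
    (h : ∀ x y, f x * g y ≤ w ((x + y) / 2) ^ 2) :
    (∫⁻ x, ENNReal.ofReal (f x)) + ∫⁻ x, ENNReal.ofReal (g x)
      ≤ 2 * ∫⁻ x, ENNReal.ofReal (w x) := by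
  -- Layer cake: for t < 1 the superlevel sets of f and g are nonempty and their midpoints lie in
  -- that of w, so Brunn–Minkowski applies; for t ≥ 1 those of f and g are empty.
  have key : ∀ t ∈ Set.Ioi (0 : ℝ),
      volume {x | t < f x} + volume {x | t < g x} ≤ 2 * volume {x | t < w x} := by
    intro t ht
    rcases lt_or_ge t 1 with ht1 | ht1
    · refine volume_add_volume_le (measurableSet_lt measurable_const hf)
        (measurableSet_lt measurable_const hg) (hfs t ht ht1) (hgs t ht ht1) fun x hx y hy => ?_
      have h0 : (0 : ℝ) < t := ht
      have : t ^ 2 < w ((x + y) / 2) ^ 2 :=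
        (by nlinarith [hx.out, hy.out] : t ^ 2 < f x * g y).trans_le (h x y)
      exact lt_of_pow_lt_pow_left₀ 2 (hw0 _) this
    · have e1 : {x | t < f x} = ∅ :=
        Set.eq_empty_of_forall_notMem fun x hx => absurd (hf1 x) (not_le.2 (ht1.trans_lt hx))
      have e2 : {x | t < g x} = ∅ :=
        Set.eq_empty_of_forall_notMem fun x hx => absurd (hg1 x) (not_le.2 (ht1.trans_lt hx))
      simp [e1, e2]
  rw [lintegral_eq_lintegral_meas_lt _ (ae_of_all _ hf0) hf.aemeasurable,
    lintegral_eq_lintegral_meas_lt _ (ae_of_all _ hg0) hg.aemeasurable,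
    lintegral_eq_lintegral_meas_lt _ (ae_of_all _ hw0) hw.aemeasurable,
    ← lintegral_add_left, ← lintegral_const_mul]
  · exact setLIntegral_mono' measurableSet_Ioi key
  all_goals
    refine Antitone.measurable fun s t hst => measure_mono fun x hx => lt_of_le_of_lt hst hx

/-- By AM–GM, 4FG ≤ (F + G)². This turns the additive inequality for normalized functions into the
multiplicative one. -/
theorem ennreal_mul_le_sq_of_add_le {F G W : ℝ≥0∞} (main : F + G ≤ 2 * W) : F * G ≤ W ^ 2 := by
  rcases eq_or_ne W ⊤ with hWt | hWt
  · simp [hWt]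
  have hFt : F ≠ ⊤ := ne_top_of_le_ne_top (by finiteness) (le_self_add.trans main)
  have hGt : G ≠ ⊤ := ne_top_of_le_ne_top (by finiteness) (le_add_self.trans main)
  lift F to NNReal using hFt
  lift G to NNReal using hGt
  lift W to NNReal using hWt
  norm_cast at main ⊢
  rw [← NNReal.coe_le_coe] at main ⊢
  push_cast at main ⊢
  nlinarith [sq_nonneg ((F : ℝ) - G), F.coe_nonneg, G.coe_nonneg, W.coe_nonneg]

/-- The Prékopa–Leindler inequality for bounded functions. -/
theorem prekopa_leindler_of_bounded {u v : ℝ → ℝ≥0∞} {w : ℝ → ℝ} (hu : Measurable u)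
    (hv : Measurable v) (hw : Measurable w) (hw0 : 0 ≤ w) {a b : ℝ≥0∞}
    (ha : a ≠ ⊤) (hb : b ≠ ⊤) (hua : ∀ x, u x ≤ a) (hvb : ∀ x, v x ≤ b)
    (h : ∀ x y, u x * v y ≤ ENNReal.ofReal (w ((x + y) / 2)) ^ 2) :
    (∫⁻ x, u x) * ∫⁻ x, v x ≤ (∫⁻ x, ENNReal.ofReal (w x)) ^ 2 := by
  set A := ⨆ x, u x with hA
  set B := ⨆ x, v x with hB
  have hAt : A ≠ ⊤ := ((iSup_le hua).trans_lt ha.lt_top).ne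
  have hBt : B ≠ ⊤ := ((iSup_le hvb).trans_lt hb.lt_top).ne
  rcases eq_or_ne A 0 with h0 | hA0
  · have : u = 0 := funext fun x => le_antisymm ((le_iSup u x).trans h0.le) bot_le
    simp [this]
  rcases eq_or_ne B 0 with h0 | hB0
  · have : v = 0 := funext fun x => le_antisymm ((le_iSup v x).trans h0.le) bot_le
    simp [this]
  have hAp : 0 < A.toReal := ENNReal.toReal_pos hA0 hAt
  have hBp : 0 < B.toReal := ENNReal.toReal_pos hB0 hBt
  have hut : ∀ x, u x ≠ ⊤ := fun x => ((hua x).trans_lt ha.lt_top).ne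
  have hvt : ∀ x, v x ≠ ⊤ := fun x => ((hvb x).trans_lt hb.lt_top).ne
  have norm : ∀ (z : ℝ → ℝ≥0∞), Measurable z → (⨆ x, z x) ≠ 0 → (⨆ x, z x) ≠ ⊤ →
      (∀ x, z x ≠ ⊤) → (∀ t : ℝ, 0 < t → t < 1 → ∃ x, t < (z x).toReal / (⨆ x, z x).toReal) ∧
      (∀ x, (z x).toReal / (⨆ x, z x).toReal ≤ 1) ∧
      ∫⁻ x, z x = (⨆ x, z x) * ∫⁻ x, ENNReal.ofReal ((z x).toReal / (⨆ x, z x).toReal) := by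
    intro z hz h0 ht hzt
    have hp : 0 < (⨆ x, z x).toReal := ENNReal.toReal_pos h0 ht
    refine ⟨fun t ht0 ht1 => ?_, fun x => ?_, ?_⟩
    · have : ENNReal.ofReal (t * (⨆ x, z x).toReal) < ⨆ x, z x := by
        rw [ENNReal.ofReal_lt_iff_lt_toReal (by positivity) ht]
        nlinarith
      obtain ⟨x, hx⟩ := lt_iSup_iff.1 this
      refine ⟨x, ?_⟩
      rw [lt_div_iff₀ hp]
      exact (ENNReal.ofReal_lt_iff_lt_toReal (by positivity) (hzt x)).1 hx
    · rw [div_le_one hp]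
      exact ENNReal.toReal_mono ht (le_iSup z x)
    · rw [← lintegral_const_mul _ (by fun_prop)]
      refine lintegral_congr fun x => ?_
      rw [ENNReal.ofReal_div_of_pos hp, ENNReal.ofReal_toReal (hzt x), ENNReal.ofReal_toReal ht,
        ENNReal.mul_div_cancel h0 ht]
  obtain ⟨hfs, hf1, hfi⟩ := norm u hu hA0 hAt hut
  obtain ⟨hgs, hg1, hgi⟩ := norm v hv hB0 hBt hvt
  rw [← hA] at hfs hf1 hfi
  rw [← hB] at hgs hg1 hgi
  -- Once u and v are divided by their suprema A and B, the pointwise hypothesis survives exactly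
  -- when w is divided by √(AB).
  set c := Real.sqrt (A.toReal * B.toReal) with hc
  have hcp : 0 < c := Real.sqrt_pos.2 (mul_pos hAp hBp)
  have hc2 : c ^ 2 = A.toReal * B.toReal := Real.sq_sqrt (mul_pos hAp hBp).le
  have main := lintegral_add_lintegral_le (f := fun x => (u x).toReal / A.toReal)
    (g := fun x => (v x).toReal / B.toReal) (w := fun x => w x / c) (by fun_prop) (by fun_prop)
    (by fun_prop) (fun x => by positivity) (fun x => by positivity)
    (fun x => div_nonneg (hw0 x) hcp.le) hf1 hg1 hfs hgs (by
      intro x y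
      have := ENNReal.toReal_mono (by finiteness) (h x y)
      rw [ENNReal.toReal_mul, ENNReal.toReal_pow, ENNReal.toReal_ofReal (hw0 _)] at this
      rw [div_mul_div_comm, div_pow, hc2]
      gcongr)
  set F := ∫⁻ x, ENNReal.ofReal ((u x).toReal / A.toReal)
  set G := ∫⁻ x, ENNReal.ofReal ((v x).toReal / B.toReal)
  have hW : ∫⁻ x, ENNReal.ofReal (w x) = ENNReal.ofReal c * ∫⁻ x, ENNReal.ofReal (w x / c) := by
    rw [← lintegral_const_mul _ (by fun_prop)]
    refine lintegral_congr fun x => ?_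
    rw [← ENNReal.ofReal_mul hcp.le, mul_div_cancel₀ _ hcp.ne']
  set W := ∫⁻ x, ENNReal.ofReal (w x / c)
  have hFG : F * G ≤ W ^ 2 := ennreal_mul_le_sq_of_add_le main
  calc (∫⁻ x, u x) * ∫⁻ x, v x = (A * B) * (F * G) := by rw [hfi, hgi]; ring
    _ ≤ (A * B) * W ^ 2 := by gcongr
    _ = _ := by
      rw [hW, mul_pow, ← ENNReal.ofReal_pow hcp.le, hc2, ENNReal.ofReal_mul hAp.le,
        ENNReal.ofReal_toReal hAt, ENNReal.ofReal_toReal hBt]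

/-- The one-dimensional Prékopa–Leindler inequality. -/
theorem prekopa_leindler {u v : ℝ → ℝ≥0∞} {w : ℝ → ℝ} (hu : Measurable u)
    (hv : Measurable v) (hw : Measurable w) (hw0 : 0 ≤ w)
    (h : ∀ x y, u x * v y ≤ ENNReal.ofReal (w ((x + y) / 2)) ^ 2) :
    (∫⁻ x, u x) * ∫⁻ x, v x ≤ (∫⁻ x, ENNReal.ofReal (w x)) ^ 2 := by
  -- Truncation makes the suprema finite; monotone convergence removes it.
  have trunc : ∀ z : ℝ → ℝ≥0∞, Measurable z → ∫⁻ x, z x = ⨆ n : ℕ, ∫⁻ x, min (z x) n := by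
    intro z hz
    rw [← lintegral_iSup (fun n => by fun_prop)]
    · refine lintegral_congr fun x => ?_
      rw [← inf_iSup_eq, ENNReal.iSup_natCast, inf_top_eq]
    · intro m n hmn x
      simp only
      gcongr
  rw [trunc u hu, trunc v hv, ENNReal.iSup_mul]
  refine iSup_le fun m => ?_
  rw [ENNReal.mul_iSup]
  refine iSup_le fun n => ?_
  refine prekopa_leindler_of_bounded (by fun_prop) (by fun_prop) hw hw0
    (ENNReal.natCast_ne_top m) (ENNReal.natCast_ne_top n) (fun x => min_le_right _ _)
    (fun x => min_le_right _ _) fun x y => le_trans ?_ (h x y)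
  gcongr <;> exact min_le_left _ _

/-! ### Infimum-convolution inequality for Gaussian measures -/

/-- Maurey's property (τ) of the standard Gaussian measure on the line. -/
theorem gaussianReal_lintegral_mul_le {u v : ℝ → ℝ≥0∞} (hu : Measurable u) (hv : Measurable v)
    (h : ∀ x y, u x * v y ≤ ENNReal.ofReal (Real.exp ((x - y) ^ 2 / 4))) :
    (∫⁻ x, u x ∂gaussianReal 0 1) * ∫⁻ x, v x ∂gaussianReal 0 1 ≤ 1 := by
  rw [gaussianReal_of_var_ne_zero 0 one_ne_zero,
    lintegral_withDensity_eq_lintegral_mul _ (measurable_gaussianPDF 0 1) hu,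
    lintegral_withDensity_eq_lintegral_mul _ (measurable_gaussianPDF 0 1) hv]
  -- The Gaussian density φ satisfies φ(x)φ(y)exp((x−y)²/4) = φ((x+y)/2)², by the parallelogram
  -- identity.
  refine (prekopa_leindler (w := gaussianPDFReal 0 1) ((measurable_gaussianPDF 0 1).mul hu)
    ((measurable_gaussianPDF 0 1).mul hv) (measurable_gaussianPDFReal 0 1)
    (fun x => gaussianPDFReal_nonneg 0 1 x) fun x y => ?_).trans ?_
  · simp only [Pi.mul_apply, gaussianPDF]
    calc _ = (ENNReal.ofReal (gaussianPDFReal 0 1 x) * ENNReal.ofReal (gaussianPDFReal 0 1 y)) *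
          (u x * v y) := by ring
      _ ≤ (ENNReal.ofReal (gaussianPDFReal 0 1 x) * ENNReal.ofReal (gaussianPDFReal 0 1 y)) *
          ENNReal.ofReal (Real.exp ((x - y) ^ 2 / 4)) := by gcongr; exact h x y
      _ = _ := by
        rw [← ENNReal.ofReal_mul (gaussianPDFReal_nonneg _ _ _), ← ENNReal.ofReal_mul
          (mul_nonneg (gaussianPDFReal_nonneg _ _ _) (gaussianPDFReal_nonneg _ _ _)),
          ← ENNReal.ofReal_pow (gaussianPDFReal_nonneg _ _ _)]
        congr 1
        simp only [gaussianPDFReal, mul_pow, ← Real.exp_nat_mul]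
        rw [mul_mul_mul_comm, ← Real.exp_add, mul_assoc, ← Real.exp_add, ← sq]
        congr 2
        push_cast
        ring
  · have := lintegral_gaussianPDF_eq_one 0 (v := 1) one_ne_zero
    simp only [gaussianPDF] at this
    simp [this]

/-- The standard Gaussian measure on `ℝⁿ`. -/
noncomputable abbrev stdGaussianPi (n : ℕ) : Measure (Fin n → ℝ) :=
  Measure.pi fun _ => gaussianReal 0 1

theorem lintegral_stdGaussianPi_succ {n : ℕ} {f : (Fin (n + 1) → ℝ) → ℝ≥0∞} (hf : Measurable f) :
    ∫⁻ x, f x ∂stdGaussianPi (n + 1)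
      = ∫⁻ s, ∫⁻ x, f (Fin.cons s x) ∂stdGaussianPi n ∂gaussianReal 0 1 := by
  have hmp := (measurePreserving_piFinSuccAbove (fun _ : Fin (n + 1) => gaussianReal 0 1) 0).symm
  rw [← hmp.lintegral_comp hf]
  refine (lintegral_prod _ (hf.comp hmp.measurable).aemeasurable).trans ?_
  simp [MeasurableEquiv.piFinSuccAbove, Fin.insertNthEquiv]

/-- Maurey's property (τ) of the standard Gaussian measure on `ℝⁿ`. -/
theorem stdGaussianPi_lintegral_mul_le {n : ℕ} {u v : (Fin n → ℝ) → ℝ≥0∞} (hu : Measurable u)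
    (hv : Measurable v)
    (h : ∀ x y, u x * v y ≤ ENNReal.ofReal (Real.exp ((∑ i, (x i - y i) ^ 2) / 4))) :
    (∫⁻ x, u x ∂stdGaussianPi n) * ∫⁻ x, v x ∂stdGaussianPi n ≤ 1 := by
  induction n with
  | zero =>
    rw [stdGaussianPi, Measure.pi_of_empty, lintegral_dirac, lintegral_dirac]
    simpa using h isEmptyElim isEmptyElim
  | succ n ih =>
    have hcons : Measurable fun p : ℝ × (Fin n → ℝ) => (Fin.cons p.1 p.2 : Fin (n + 1) → ℝ) := by
      simpa [MeasurableEquiv.piFinSuccAbove, Fin.insertNthEquiv] using (MeasurableEquiv.piFinSuccAbove (fun _ : Fin (n + 1) => ℝ) 0).symm.measurable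
    rw [lintegral_stdGaussianPi_succ hu, lintegral_stdGaussianPi_succ hv]
    refine gaussianReal_lintegral_mul_le (Measurable.lintegral_prod_right' (hu.comp hcons))
      (Measurable.lintegral_prod_right' (hv.comp hcons)) fun s t => ?_
    -- For fixed first coordinates s and t, the slices satisfy the n-dimensional hypothesis up to
    -- the factor e. The induction hypothesis then says that the partial integrals satisfy the
    -- one-dimensional hypothesis.
    set e := ENNReal.ofReal (Real.exp ((s - t) ^ 2 / 4)) with he
    have he0 : e ≠ 0 := by simp [he, Real.exp_pos]
    have het : e ≠ ⊤ := ENNReal.ofReal_ne_top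
    have hus : Measurable fun x : Fin n → ℝ => u (Fin.cons s x) :=
      hu.comp (hcons.comp measurable_prodMk_left)
    have hvt : Measurable fun x : Fin n → ℝ => v (Fin.cons t x) :=
      hv.comp (hcons.comp measurable_prodMk_left)
    have := ih (u := fun x => e⁻¹ * u (Fin.cons s x)) (hus.const_mul _) hvt fun x y => by
      have := h (Fin.cons s x) (Fin.cons t y)
      simp only [Fin.sum_univ_succ, Fin.cons_zero, Fin.cons_succ] at this
      rw [mul_assoc, ENNReal.inv_mul_le_iff he0 het, he, ← ENNReal.ofReal_mul (Real.exp_pos _).le,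
        ← Real.exp_add, ← add_div]
      exact this
    rwa [lintegral_const_mul _ hus, mul_assoc, ENNReal.inv_mul_le_iff he0 het, mul_one] at this

end RadialNLS

namespace RadialNLS

/-! ### Moments of Gaussian sums in a Hilbert space -/

theorem integrable_pow_gaussianReal (k : ℕ) : Integrable (fun t : ℝ => t ^ k) (gaussianReal 0 1) := by
  rcases eq_or_ne k 0 with rfl | hk
  · simp
  have := (memLp_id_gaussianReal (μ := 0) (v := 1) k).integrable_norm_pow hk
  refine this.mono (by fun_prop) (ae_of_all _ fun t => by simp)

theorem integral_sq_gaussianReal : ∫ t, t ^ 2 ∂gaussianReal 0 1 = 1 := by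
  have := variance_fun_id_gaussianReal (μ := 0) (v := 1)
  rw [variance_of_integral_eq_zero (by fun_prop) (by simp)] at this
  simpa using this

/-- A constant for the fourth moments of Gaussian sums. -/
noncomputable def fourthMomentConst : ℝ := 4 + 3 * ∫ t, t ^ 4 ∂gaussianReal 0 1

theorem four_le_fourthMomentConst : 4 ≤ fourthMomentConst := by
  have : 0 ≤ ∫ t, t ^ 4 ∂gaussianReal 0 1 := integral_nonneg fun t => by positivity
  unfold fourthMomentConst
  linarith

theorem enorm_pow_eq_ofReal {H : Type*} [NormedAddCommGroup H] (v : H) (k : ℕ) : ‖v‖ₑ ^ k = ENNReal.ofReal (‖v‖ ^ k) := by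
  rw [← ofReal_norm, ENNReal.ofReal_pow (norm_nonneg _)]

variable {H : Type*} [NormedAddCommGroup H] [InnerProductSpace ℝ H]

theorem lintegral_enorm_add_smul_sq (s a : H) :
    ∫⁻ t, ‖s + t • a‖ₑ ^ 2 ∂gaussianReal 0 1 = ‖s‖ₑ ^ 2 + ‖a‖ₑ ^ 2 := by
  have h1 : Integrable (fun t : ℝ => t) (gaussianReal 0 1) := by
    simpa using integrable_pow_gaussianReal 1
  have h2 := integrable_pow_gaussianReal 2
  have c1 : ∀ a b : ℝ, Integrable (fun t : ℝ => a + t * b) (gaussianReal 0 1) :=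
    fun a b => (integrable_const a).add (h1.mul_const b)
  have e : ∀ t : ℝ, ‖s + t • a‖ ^ 2 = ‖s‖ ^ 2 + t * (2 * inner ℝ s a) + t ^ 2 * ‖a‖ ^ 2 := by
    intro t
    rw [norm_add_sq_real, inner_smul_right, norm_smul, mul_pow, Real.norm_eq_abs, sq_abs]
    ring
  simp_rw [enorm_pow_eq_ofReal, e]
  rw [← ofReal_integral_eq_lintegral_ofReal, ← ENNReal.ofReal_add (by positivity) (by positivity)]
  · rw [integral_add (c1 _ _) (h2.mul_const _), integral_add (integrable_const _) (h1.mul_const _),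
      integral_mul_const, integral_mul_const, integral_sq_gaussianReal, integral_id_gaussianReal]
    simp
  · exact (c1 _ _).add (h2.mul_const _)
  · exact ae_of_all _ fun t => (sq_nonneg _).trans_eq (e t)

/-- The odd moment in t vanishes and the others are absorbed by Cauchy–Schwarz. The bound is kept as
a perfect square so that it iterates: each further Gaussian summand only adds a term inside the
square, which yields a dimension-free bound. -/
theorem lintegral_enorm_add_smul_pow_four_le (s a : H) :
    ∫⁻ t, ‖s + t • a‖ₑ ^ 4 ∂gaussianReal 0 1
      ≤ (‖s‖ₑ ^ 2 + ENNReal.ofReal fourthMomentConst * ‖a‖ₑ ^ 2) ^ 2 := by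
  have h1 : Integrable (fun t : ℝ => t) (gaussianReal 0 1) := by
    simpa using integrable_pow_gaussianReal 1
  have h2 := integrable_pow_gaussianReal 2
  have h4 := integrable_pow_gaussianReal 4
  have c1 : ∀ a b : ℝ, Integrable (fun t : ℝ => a + t * b) (gaussianReal 0 1) :=
    fun a b => (integrable_const a).add (h1.mul_const b)
  have c2 : ∀ a b c : ℝ, Integrable (fun t : ℝ => a + t * b + t ^ 2 * c) (gaussianReal 0 1) :=
    fun a b c => (c1 a b).add (h2.mul_const c)
  set x := inner ℝ s a with hx
  have hxs : x ^ 2 ≤ ‖s‖ ^ 2 * ‖a‖ ^ 2 := by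
    rw [← sq_abs, ← mul_pow]
    exact pow_le_pow_left₀ (abs_nonneg _) (abs_real_inner_le_norm s a) 2
  have e : ∀ t : ℝ, ‖s + t • a‖ ^ 2 = ‖s‖ ^ 2 + t * (2 * x) + t ^ 2 * ‖a‖ ^ 2 := by
    intro t
    rw [norm_add_sq_real, inner_smul_right, norm_smul, mul_pow, Real.norm_eq_abs, sq_abs]
    ring
  -- In the expanded square the cubic term obeys 4t³x‖a‖² ≤ 2t²x² + 2t⁴‖a‖⁴; then x² ≤ ‖s‖²‖a‖²
  -- produces the constants 8 and 3.
  have e4 : ∀ t : ℝ, ‖s + t • a‖ ^ 4 ≤ ‖s‖ ^ 4 + t * (4 * x * ‖s‖ ^ 2)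
      + t ^ 2 * (8 * (‖s‖ ^ 2 * ‖a‖ ^ 2)) + t ^ 4 * (3 * ‖a‖ ^ 4) := by
    intro t
    have : ‖s + t • a‖ ^ 4 = (‖s‖ ^ 2 + t * (2 * x) + t ^ 2 * ‖a‖ ^ 2) ^ 2 := by rw [← e]; ring
    rw [this]
    nlinarith [mul_le_mul_of_nonneg_left hxs (sq_nonneg t), sq_nonneg (t * x - t ^ 2 * ‖a‖ ^ 2)]
  calc ∫⁻ t, ‖s + t • a‖ₑ ^ 4 ∂gaussianReal 0 1
      ≤ ∫⁻ t, ENNReal.ofReal (‖s‖ ^ 4 + t * (4 * x * ‖s‖ ^ 2)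
      + t ^ 2 * (8 * (‖s‖ ^ 2 * ‖a‖ ^ 2)) + t ^ 4 * (3 * ‖a‖ ^ 4)) ∂gaussianReal 0 1 := by
        refine lintegral_mono fun t => ?_
        rw [enorm_pow_eq_ofReal]
        exact ENNReal.ofReal_le_ofReal (e4 t)
    _ = ENNReal.ofReal (‖s‖ ^ 4 + 8 * (‖s‖ ^ 2 * ‖a‖ ^ 2)
          + (∫ t, t ^ 4 ∂gaussianReal 0 1) * (3 * ‖a‖ ^ 4)) := by
        rw [← ofReal_integral_eq_lintegral_ofReal]
        · rw [integral_add (c2 _ _ _) (h4.mul_const _), integral_add (c1 _ _) (h2.mul_const _),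
            integral_add (integrable_const _) (h1.mul_const _),
            integral_mul_const, integral_mul_const, integral_mul_const, integral_sq_gaussianReal,
            integral_id_gaussianReal]
          simp
        · exact (c2 _ _ _).add (h4.mul_const _)
        · exact ae_of_all _ fun t => le_trans (by positivity) (e4 t)
    _ ≤ ENNReal.ofReal ((‖s‖ ^ 2 + fourthMomentConst * ‖a‖ ^ 2) ^ 2) := by
        refine ENNReal.ofReal_le_ofReal ?_
        have hm : 0 ≤ ∫ t, t ^ 4 ∂gaussianReal 0 1 := integral_nonneg fun t => by positivity
        unfold fourthMomentConst
        set m := ∫ t, t ^ 4 ∂gaussianReal 0 1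
        have : 0 ≤ ‖s‖ ^ 2 * ‖a‖ ^ 2 := by positivity
        have : 0 ≤ ‖a‖ ^ 4 := by positivity
        nlinarith [mul_nonneg hm ‹0 ≤ ‖s‖ ^ 2 * ‖a‖ ^ 2›, mul_nonneg hm ‹0 ≤ ‖a‖ ^ 4›,
          mul_nonneg (mul_nonneg hm hm) ‹0 ≤ ‖a‖ ^ 4›]
    _ = _ := by
        have := four_le_fourthMomentConst
        rw [enorm_pow_eq_ofReal, enorm_pow_eq_ofReal, ← ENNReal.ofReal_mul (by linarith),
          ← ENNReal.ofReal_add (by positivity) (by positivity), ENNReal.ofReal_pow (by positivity)]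

theorem measurable_enorm_add_sum_pow {n : ℕ} (s : H) (h : Fin n → H) (k : ℕ) :
    Measurable fun x : Fin n → ℝ => ‖s + ∑ i, x i • h i‖ₑ ^ k :=
  Continuous.measurable (by fun_prop)

theorem lintegral_enorm_add_sum_sq {n : ℕ} (s : H) (h : Fin n → H) :
    ∫⁻ x, ‖s + ∑ i, x i • h i‖ₑ ^ 2 ∂stdGaussianPi n = ‖s‖ₑ ^ 2 + ∑ i, ‖h i‖ₑ ^ 2 := by
  induction n generalizing s with
  | zero => simp
  | succ n ih =>
    rw [lintegral_stdGaussianPi_succ (measurable_enorm_add_sum_pow s h 2)]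
    simp only [Fin.sum_univ_succ, Fin.cons_zero, Fin.cons_succ, ← add_assoc]
    simp_rw [ih]
    rw [lintegral_add_right _ measurable_const, lintegral_enorm_add_smul_sq]
    simp

theorem lintegral_enorm_add_sum_pow_four_le {n : ℕ} (s : H) (h : Fin n → H) :
    ∫⁻ x, ‖s + ∑ i, x i • h i‖ₑ ^ 4 ∂stdGaussianPi n
      ≤ (‖s‖ₑ ^ 2 + ENNReal.ofReal fourthMomentConst * ∑ i, ‖h i‖ₑ ^ 2) ^ 2 := by
  induction n generalizing s with
  | zero => simp [← pow_mul]
  | succ n ih =>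
    rw [lintegral_stdGaussianPi_succ (measurable_enorm_add_sum_pow s h 4)]
    simp only [Fin.sum_univ_succ, Fin.cons_zero, Fin.cons_succ, ← add_assoc]
    set c := ENNReal.ofReal fourthMomentConst with hc
    have hc1 : 1 ≤ c := by
      rw [hc, ENNReal.one_le_ofReal]
      linarith [four_le_fourthMomentConst]
    set R := ∑ i : Fin n, ‖h i.succ‖ₑ ^ 2 with hR
    have m2 : Measurable fun t : ℝ => ‖s + t • h 0‖ₑ ^ 2 := Continuous.measurable (by fun_prop)
    have m4 : Measurable fun t : ℝ => ‖s + t • h 0‖ₑ ^ 4 := Continuous.measurable (by fun_prop)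
    calc _ ≤ ∫⁻ t, (‖s + t • h 0‖ₑ ^ 2 + c * R) ^ 2 ∂gaussianReal 0 1 :=
          lintegral_mono fun t => ih (s + t • h 0) fun i => h i.succ
      _ = ∫⁻ t, ‖s + t • h 0‖ₑ ^ 4 + ((2 * c * R) * ‖s + t • h 0‖ₑ ^ 2 + (c * R) ^ 2)
            ∂gaussianReal 0 1 := lintegral_congr fun t => by ring
      _ = (∫⁻ t, ‖s + t • h 0‖ₑ ^ 4 ∂gaussianReal 0 1) +
            ((2 * c * R) * (‖s‖ₑ ^ 2 + ‖h 0‖ₑ ^ 2) + (c * R) ^ 2) := by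
          rw [lintegral_add_left m4, lintegral_add_right _ measurable_const,
            lintegral_const_mul _ m2, lintegral_enorm_add_smul_sq]
          simp
      _ ≤ (‖s‖ₑ ^ 2 + c * ‖h 0‖ₑ ^ 2) ^ 2 +
            ((2 * c * R) * (‖s‖ₑ ^ 2 + c * ‖h 0‖ₑ ^ 2) + (c * R) ^ 2) := by
          gcongr
          · exact lintegral_enorm_add_smul_pow_four_le s (h 0)
          · exact le_mul_of_one_le_left bot_le hc1
      _ = _ := by ring

/-! ### Kolmogorov's maximal inequality -/

theorem isClosed_le_partialSum {n : ℕ} (s : H) (h : Fin n → H) (l : ℝ≥0∞) (k : ℕ) :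
    IsClosed {x : Fin n → ℝ | l ≤ ‖s + ∑ i, if i.val < k then x i • h i else 0‖ₑ ^ 2} := by
  refine isClosed_le continuous_const ((ENNReal.continuous_pow 2).comp (continuous_enorm.comp
    (continuous_const.add (continuous_finsetSum _ fun i _ => ?_))))
  split_ifs <;> fun_prop

/-- Induction by conditioning on the first coordinate t, with an arbitrary starting point s. If ‖s‖²
is already at least l the bound is trivial; otherwise any exceedance is one of the walk restarted
from s + t h₀, and averaging ‖s + t h₀‖² over t adds exactly ‖h₀‖². -/
theorem mul_measure_exists_le_partialSum_le {n : ℕ} (s : H) (h : Fin n → H) (l : ℝ≥0∞) :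
    l * stdGaussianPi n {x | ∃ k : ℕ, l ≤ ‖s + ∑ i, if i.val < k then x i • h i else 0‖ₑ ^ 2}
      ≤ ‖s‖ₑ ^ 2 + ∑ i, ‖h i‖ₑ ^ 2 := by
  induction n generalizing s with
  | zero =>
    by_cases hl : l ≤ ‖s‖ₑ ^ 2
    · simp [hl]
    · simp [hl]
  | succ n ih =>
    by_cases hl : l ≤ ‖s‖ₑ ^ 2
    · exact (mul_le_of_le_one_right bot_le prob_le_one).trans (hl.trans le_self_add)
    have hmeas : MeasurableSet {x : Fin (n + 1) → ℝ |
        ∃ k : ℕ, l ≤ ‖s + ∑ i, if i.val < k then x i • h i else 0‖ₑ ^ 2} := by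
      rw [Set.ofPred_exists]
      exact MeasurableSet.iUnion fun k => (isClosed_le_partialSum s h l k).measurableSet
    have hmeas' : ∀ t : ℝ, MeasurableSet {x : Fin n → ℝ |
        ∃ k : ℕ, l ≤ ‖s + t • h 0 + ∑ i, if i.val < k then x i • h i.succ else 0‖ₑ ^ 2} := by
      intro t
      rw [Set.ofPred_exists]
      exact MeasurableSet.iUnion fun k =>
        (isClosed_le_partialSum (s + t • h 0) (fun i => h i.succ) l k).measurableSet
    rw [← lintegral_indicator_one hmeas,
      lintegral_stdGaussianPi_succ (measurable_one.indicator hmeas)]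
    calc _ ≤ l * ∫⁻ t, stdGaussianPi n {x : Fin n → ℝ |
          ∃ k : ℕ, l ≤ ‖s + t • h 0 + ∑ i, if i.val < k then x i • h i.succ else 0‖ₑ ^ 2}
            ∂gaussianReal 0 1 := by
          gcongr with t
          rw [← lintegral_indicator_one (hmeas' t)]
          refine lintegral_mono fun x => ?_
          refine Set.indicator_apply_le' (fun hx => ?_) fun _ => bot_le
          obtain ⟨k, hk⟩ := hx
          rw [Set.indicator_of_mem]
          · rfl
          · rcases k with _ | k
            · simp [hl] at hk
            · refine ⟨k, ?_⟩
              simpa [Fin.sum_univ_succ, add_assoc] using hk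
      _ ≤ ∫⁻ t, ‖s + t • h 0‖ₑ ^ 2 + ∑ i : Fin n, ‖h i.succ‖ₑ ^ 2 ∂gaussianReal 0 1 := by
          refine (lintegral_const_mul_le l _).trans ?_
          exact lintegral_mono fun t => ih (s + t • h 0) fun i => h i.succ
      _ = _ := by
          rw [lintegral_add_right _ measurable_const, lintegral_enorm_add_smul_sq,
            Fin.sum_univ_succ]
          simp [add_assoc]

/-! ### Almost sure convergence of Gaussian series -/

instance : IsProbabilityMeasure gaussianSequence := by
  unfold gaussianSequence
  infer_instance

theorem map_gaussianSequence (m n : ℕ) :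
    gaussianSequence.map (fun g (i : Fin n) => g (m + i)) = stdGaussianPi n := by
  have := Measure.map_infinitePi_infinitePi_of_inj (P := fun _ : ℕ => gaussianReal 0 1)
    (f := fun i : Fin n => m + i.val) (fun i j hij => Fin.ext (by simpa using hij))
  exact this.trans (Measure.infinitePi_eq_pi _)

theorem measurable_shift (m n : ℕ) : Measurable fun (g : ℕ → ℝ) (i : Fin n) => g (m + i) := by
  fun_prop

theorem mul_gaussianSequence_exists_le_partialSum_le (h : ℕ → H) (l : ℝ≥0∞) (m : ℕ) :
    l * gaussianSequence {g | ∃ k : ℕ, l ≤ ‖∑ i ∈ Finset.range k, g (m + i) • h (m + i)‖ₑ ^ 2}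
      ≤ ∑' i, ‖h (m + i)‖ₑ ^ 2 := by
  set E : ℕ → Set (ℕ → ℝ) := fun n =>
    {g | ∃ k ≤ n, l ≤ ‖∑ i ∈ Finset.range k, g (m + i) • h (m + i)‖ₑ ^ 2} with hE
  have hU : {g : ℕ → ℝ | ∃ k : ℕ, l ≤ ‖∑ i ∈ Finset.range k, g (m + i) • h (m + i)‖ₑ ^ 2}
      = ⋃ n, E n := by
    ext g
    simp only [hE, Set.mem_ofPred_eq, Set.mem_iUnion]
    exact ⟨fun ⟨k, hk⟩ => ⟨k, k, le_rfl, hk⟩, fun ⟨_, k, _, hk⟩ => ⟨k, hk⟩⟩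
  have hmono : Monotone E := fun n n' hn g ⟨k, hk, hk'⟩ => ⟨k, hk.trans hn, hk'⟩
  rw [hU, hmono.measure_iUnion, ENNReal.mul_iSup]
  refine iSup_le fun n => ?_
  have h1 : ∑ i : Fin n, ‖h (m + i)‖ₑ ^ 2 ≤ ∑' i, ‖h (m + i)‖ₑ ^ 2 := by
    rw [Fin.sum_univ_eq_sum_range fun i => ‖h (m + i)‖ₑ ^ 2]
    exact ENNReal.sum_le_tsum _
  refine le_trans ?_ h1
  have h2 := mul_measure_exists_le_partialSum_le (0 : H) (fun i : Fin n => h (m + i)) l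
  rw [← map_gaussianSequence m n] at h2
  simp only [enorm_zero, ne_eq, OfNat.ofNat_ne_zero, not_false_eq_true, zero_pow, zero_add] at h2
  refine le_trans ?_ h2
  gcongr
  refine le_trans (measure_mono ?_) (Measure.le_map_apply (measurable_shift m n).aemeasurable _)
  rintro g ⟨k, hkn, hk⟩
  refine ⟨k, ?_⟩
  convert hk using 4
  rw [Fin.sum_univ_eq_sum_range (fun i => if i < k then g (m + i) • h (m + i) else 0),
    ← Finset.sum_filter]
  congr 1
  ext i
  simp only [Finset.mem_filter, Finset.mem_range]
  omega

/-- A Gaussian series with square summable coefficients converges almost surely. -/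
theorem ae_exists_tendsto_gaussian_sum [CompleteSpace H] {h : ℕ → H}
    (hh : ∑' i, ‖h i‖ₑ ^ 2 ≠ ⊤) :
    ∀ᵐ g ∂gaussianSequence,
      ∃ v, Tendsto (fun N => ∑ n ∈ Finset.range N, g n • h n) atTop (𝓝 v) := by
  -- The maximal inequality bounds the failure probability for a given m by (j+1) times the tail sum
  -- from m, which tends to zero.
  have key : ∀ j : ℕ, ∀ᵐ g ∂gaussianSequence, ∃ m : ℕ, ∀ k : ℕ,
      ‖∑ i ∈ Finset.range k, g (m + i) • h (m + i)‖ₑ ^ 2 < ((j : ℝ≥0∞) + 1)⁻¹ := by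
    intro j
    rw [ae_iff]
    have htail : Tendsto (fun m => ((j : ℝ≥0∞) + 1) * ∑' i, ‖h (m + i)‖ₑ ^ 2) atTop (𝓝 0) := by
      have := ENNReal.tendsto_sum_nat_add (fun i => ‖h i‖ₑ ^ 2) hh
      have := ENNReal.Tendsto.const_mul (a := (j : ℝ≥0∞) + 1) this (Or.inr (by finiteness))
      simpa [add_comm] using this
    refine le_antisymm (ge_of_tendsto' htail fun m => ?_) bot_le
    have := mul_gaussianSequence_exists_le_partialSum_le h ((j : ℝ≥0∞) + 1)⁻¹ m
    rw [ENNReal.inv_mul_le_iff (by positivity) (by finiteness)] at this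
    refine le_trans (measure_mono fun g hg => ?_) this
    simp only [not_exists, not_forall, not_lt, Set.mem_ofPred_eq] at hg ⊢
    exact hg m
  filter_upwards [ae_all_iff.2 key] with g hg
  refine cauchySeq_tendsto_of_complete (Metric.cauchySeq_iff'.2 fun ε hε => ?_)
  have hε2 : ENNReal.ofReal (ε ^ 2) ≠ 0 := by simp [hε.ne']
  obtain ⟨j, hj⟩ := ENNReal.exists_inv_nat_lt hε2
  obtain ⟨m, hm⟩ := hg j
  refine ⟨m, fun n hn => ?_⟩
  obtain ⟨k, rfl⟩ := Nat.exists_eq_add_of_le hn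
  have h1 := ((hm k).trans_le (ENNReal.inv_le_inv.2 le_self_add)).trans hj
  rw [enorm_pow_eq_ofReal, ENNReal.ofReal_lt_ofReal_iff (by positivity)] at h1
  rw [dist_eq_norm, Finset.sum_range_add, add_sub_cancel_left]
  exact lt_of_pow_lt_pow_left₀ 2 hε.le h1

end RadialNLS

namespace RadialNLS

/-! ### The Cauchy–Schwarz inequality for lower integrals -/

theorem sq_lintegral_mul_le {α : Type*} [MeasurableSpace α] {μ : Measure α} {f g : α → ℝ≥0∞}
    (hf : AEMeasurable f μ) (hg : AEMeasurable g μ) :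
    (∫⁻ x, f x * g x ∂μ) ^ 2 ≤ (∫⁻ x, f x ^ 2 ∂μ) * ∫⁻ x, g x ^ 2 ∂μ := by
  have h := ENNReal.lintegral_mul_le_Lp_mul_Lq μ Real.HolderConjugate.two_two hf hg
  simp only [Pi.mul_apply, ENNReal.rpow_two] at h
  refine (pow_le_pow_left' h 2).trans_eq ?_
  rw [mul_pow, ← ENNReal.rpow_mul_natCast, ← ENNReal.rpow_mul_natCast]
  norm_num

/-! ### Radial mollifiers -/

noncomputable section

/-- A smooth radial bump function supported in the closed unit disc. -/
def radialBump (x : Plane) : ℝ := expNegInvGlue (1 - ‖x‖ ^ 2)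

theorem contDiff_radialBump : ContDiff ℝ ∞ radialBump :=
  expNegInvGlue.contDiff.comp (contDiff_const.sub (contDiff_norm_sq ℝ))

theorem radialBump_eq_zero {x : Plane} (hx : 1 ≤ ‖x‖) : radialBump x = 0 :=
  expNegInvGlue.zero_of_nonpos (by nlinarith)

theorem radialBump_nonneg (x : Plane) : 0 ≤ radialBump x := expNegInvGlue.nonneg _

theorem radialBump_le_one (x : Plane) : radialBump x ≤ 1 := by
  unfold radialBump expNegInvGlue
  split_ifs with h
  · exact zero_le_one
  · rw [Real.exp_le_one_iff, neg_nonpos, inv_nonneg]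
    exact (not_le.1 h).le

theorem hasCompactSupport_radialBump : HasCompactSupport radialBump :=
  HasCompactSupport.of_support_subset_isCompact (isCompact_closedBall (0 : Plane) 1) fun x hx => by
    rw [mem_closedBall_zero_iff]
    by_contra h
    exact hx (radialBump_eq_zero (not_le.1 h).le)

theorem integral_radialBump_pos : 0 < ∫ x, radialBump x := by
  refine contDiff_radialBump.continuous.integral_pos_of_hasCompactSupport_nonneg_nonzero
    hasCompactSupport_radialBump radialBump_nonneg (x := 0) ?_
  have : 0 < radialBump 0 := expNegInvGlue.pos_of_pos (by simp)
  exact this.ne'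

/-- The scale of the `k`-th mollifier. -/
def scale (k : ℕ) : ℝ := 1 / ((k : ℝ) + 1)

theorem scale_pos (k : ℕ) : 0 < scale k := Nat.one_div_pos_of_nat

theorem scale_le_one (k : ℕ) : scale k ≤ 1 := by
  unfold scale
  rw [div_le_one (by positivity)]
  linarith [Nat.cast_nonneg (α := ℝ) k]

/-- A sequence of smooth radial probability densities concentrating at the origin. -/
def mollifier (k : ℕ) (x : Plane) : ℝ :=
  (scale k ^ 2 * ∫ y, radialBump y)⁻¹ * radialBump ((scale k)⁻¹ • x)

theorem contDiff_mollifier (k : ℕ) : ContDiff ℝ ∞ (mollifier k) :=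
  contDiff_const.mul (contDiff_radialBump.comp (contDiff_const_smul _))

theorem mollifier_nonneg (k : ℕ) (x : Plane) : 0 ≤ mollifier k x :=
  mul_nonneg (inv_nonneg.2 (mul_nonneg (sq_nonneg _) integral_radialBump_pos.le))
    (radialBump_nonneg _)

theorem mollifier_eq_zero {k : ℕ} {x : Plane} (hx : scale k ≤ ‖x‖) : mollifier k x = 0 := by
  unfold mollifier
  rw [radialBump_eq_zero, mul_zero]
  rw [norm_smul, norm_inv, Real.norm_of_nonneg (scale_pos k).le, ← div_eq_inv_mul,
    one_le_div (scale_pos k)]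
  exact hx

theorem mollifier_radial (k : ℕ) {x y : Plane} (h : ‖x‖ = ‖y‖) : mollifier k x = mollifier k y := by
  simp [mollifier, radialBump, norm_smul, h]

theorem hasCompactSupport_mollifier (k : ℕ) : HasCompactSupport (mollifier k) :=
  HasCompactSupport.of_support_subset_isCompact (isCompact_closedBall (0 : Plane) (scale k))
    fun x hx => by
      rw [mem_closedBall_zero_iff]
      by_contra h
      exact hx (mollifier_eq_zero (not_le.1 h).le)

theorem integral_mollifier (k : ℕ) : ∫ x, mollifier k x = 1 := by
  unfold mollifier
  rw [integral_const_mul, Measure.integral_comp_smul]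
  have h1 := scale_pos k
  have h2 := integral_radialBump_pos
  simp only [finrank_euclideanSpace, Fintype.card_fin, smul_eq_mul]
  rw [abs_of_pos (by positivity)]
  field_simp

theorem lintegral_mollifier (k : ℕ) (x : Plane) : ∫⁻ y, ‖mollifier k (x - y)‖ₑ = 1 := by
  have e : ∀ y, ‖mollifier k (x - y)‖ₑ = ENNReal.ofReal (mollifier k (x - y)) := fun y =>
    Real.enorm_of_nonneg (mollifier_nonneg _ _)
  simp_rw [e]
  rw [← ofReal_integral_eq_lintegral_ofReal, integral_sub_left_eq_self, integral_mollifier,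
    ENNReal.ofReal_one]
  · exact (((contDiff_mollifier k).continuous.integrable_of_hasCompactSupport
      (hasCompactSupport_mollifier k)).comp_sub_left x)
  · exact ae_of_all _ fun y => mollifier_nonneg _ _

/-- The kernel is at most a constant over the volume of its supporting ball, as the Lebesgue
differentiation theorem requires. The centre y is free by translation invariance. -/
theorem abs_mollifier_le (k : ℕ) (x y : Plane) :
    |mollifier k x| ≤ ((volume.real (Metric.closedBall (0 : Plane) 1)) / ∫ z, radialBump z)
      / volume.real (Metric.closedBall y (scale k)) := by
  have h1 := scale_pos k
  have h2 := integral_radialBump_pos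
  rw [abs_of_nonneg (mollifier_nonneg _ _), measureReal_def, measureReal_def,
    Measure.addHaar_closedBall _ y h1.le, Measure.addHaar_closedBall _ (0 : Plane) zero_le_one]
  have hv : 0 < (volume (Metric.ball (0 : Plane) 1)).toReal :=
    ENNReal.toReal_pos (Metric.measure_ball_pos _ _ one_pos).ne' measure_ball_lt_top.ne
  simp only [finrank_euclideanSpace, Fintype.card_fin, ENNReal.toReal_mul, one_pow,
    ENNReal.toReal_ofReal (sq_nonneg (scale k)), ENNReal.ofReal_one, one_mul]
  unfold mollifier
  refine (mul_le_of_le_one_right (by positivity) (radialBump_le_one _)).trans (le_of_eq ?_)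
  field_simp

/-! ### Mollification of functions on the disc -/

/-- The convolution of the `k`-th mollifier with the extension by zero of a function on the
disc. -/
def mollify (k : ℕ) (f : Plane → ℂ) (x : Plane) : ℂ := ∫ y in disc, mollifier k (x - y) • f y

theorem measurableSet_disc : MeasurableSet disc := Metric.isOpen_ball.measurableSet

instance : IsFiniteMeasure ((volume : Measure Plane).restrict disc) :=
  ⟨by simp [disc]⟩

theorem mollify_eq_convolution (k : ℕ) (f : Plane → ℂ) :
    mollify k f = convolution (disc.indicator f) (mollifier k)
      (ContinuousLinearMap.lsmul ℝ ℝ).flip volume := by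
  ext x
  rw [convolution_def, mollify, ← integral_indicator measurableSet_disc]
  refine integral_congr_ae (ae_of_all _ fun y => ?_)
  by_cases hy : y ∈ disc <;> simp [hy]

theorem integrable_L2Disc (v : L2Disc) : Integrable v (volume.restrict disc) :=
  (Lp.memLp v).integrable one_le_two

theorem locallyIntegrable_indicator (v : L2Disc) : LocallyIntegrable (disc.indicator v) :=
  ((integrable_indicator_iff measurableSet_disc).2 (integrable_L2Disc v)).locallyIntegrable

theorem contDiff_mollify (k : ℕ) (v : L2Disc) : ContDiff ℝ ∞ (mollify k v) := by
  rw [mollify_eq_convolution]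
  exact (hasCompactSupport_mollifier k).contDiff_convolution_right _
    (locallyIntegrable_indicator v) (contDiff_mollifier k)

theorem mollify_eq_zero {k : ℕ} (f : Plane → ℂ) {x : Plane} (hx : 2 ≤ ‖x‖) :
    mollify k f x = 0 := by
  unfold mollify
  rw [setIntegral_congr_fun (g := fun _ => 0) measurableSet_disc]
  · simp
  · intro y hy
    simp only
    rw [mollifier_eq_zero, zero_smul]
    have h1 : ‖y‖ < 1 := by simpa [disc] using hy
    have h2 := norm_sub_norm_le x y
    linarith [scale_le_one k]

theorem hasCompactSupport_mollify (k : ℕ) (f : Plane → ℂ) : HasCompactSupport (mollify k f) :=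
  HasCompactSupport.of_support_subset_isCompact (isCompact_closedBall (0 : Plane) 2)
    fun x hx => by
      rw [mem_closedBall_zero_iff]
      by_contra h
      exact hx (mollify_eq_zero f (not_le.1 h).le)

/-- The derivative falls on the kernel, and y ↦ ρₖ(x − y) is an admissible test function even when
its support crosses the unit circle, because `HasGradientH10` encodes zero trace. No boundary term
appears, so the extension by zero is differentiated weakly on the whole plane. -/
theorem fderiv_mollify {v : L2Disc} {G : Fin 2 → L2Disc} (hG : HasGradientH10 v G) (k : ℕ)
    (j : Fin 2) (x : Plane) :
    fderiv ℝ (mollify k v) x (EuclideanSpace.single j 1) = mollify k (G j) x := by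
  have hd := (hasCompactSupport_mollifier k).hasFDerivAt_convolution_right
    (ContinuousLinearMap.lsmul ℝ ℝ).flip (locallyIntegrable_indicator v)
    ((contDiff_mollifier k).of_le (by simp)) x
  rw [← mollify_eq_convolution] at hd
  rw [hd.fderiv, convolution_precompR_apply _ (locallyIntegrable_indicator v)
    ((hasCompactSupport_mollifier k).fderiv ℝ)
    ((contDiff_mollifier k).continuous_fderiv (by simp)), convolution_def]
  have hψ : ContDiff ℝ ∞ fun y => mollifier k (x - y) :=
    (contDiff_mollifier k).comp (contDiff_const.sub contDiff_id)
  have hψc : HasCompactSupport fun y => mollifier k (x - y) :=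
    (hasCompactSupport_mollifier k).comp_homeomorph (Homeomorph.subLeft x)
  have hψd : ∀ y, fderiv ℝ (fun y => mollifier k (x - y)) y (EuclideanSpace.single j 1)
      = -fderiv ℝ (mollifier k) (x - y) (EuclideanSpace.single j 1) := by
    intro y
    have h1 := ((contDiff_mollifier k).differentiable (by simp) (x - y)).hasFDerivAt.comp y
      ((hasFDerivAt_const x y).sub (hasFDerivAt_id y))
    refine (congrArg (fun L => L (EuclideanSpace.single j 1)) h1.fderiv).trans ?_
    simp
  have h := hG _ hψ hψc j
  simp only [hψd, neg_smul, integral_neg, neg_inj] at h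
  rw [mollify, ← h, ← integral_indicator measurableSet_disc]
  refine integral_congr_ae (ae_of_all _ fun y => ?_)
  by_cases hy : y ∈ disc <;> simp [hy]

theorem ae_tendsto_mollify (v : L2Disc) :
    ∀ᵐ x ∂(volume.restrict disc), Tendsto (fun k => mollify k v x) atTop (𝓝 (v x)) := by
  rw [ae_restrict_iff' measurableSet_disc]
  filter_upwards [(Besicovitch.vitaliFamily volume).ae_tendsto_average_norm_sub
    (locallyIntegrable_indicator v)] with x hx hxd
  have hscale : Tendsto scale atTop (𝓝[>] 0) :=
    tendsto_nhdsWithin_iff.2 ⟨tendsto_one_div_add_atTop_nhds_zero_nat,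
      Eventually.of_forall scale_pos⟩
  have h1 := (hx.comp (Besicovitch.tendsto_filterAt volume x)).comp hscale
  have h2 := tendsto_integral_smul_of_tendsto_average_norm_sub
    (g := fun k y => mollifier k (x - y))
    ((volume.real (Metric.closedBall (0 : Plane) 1)) / ∫ z, radialBump z) h1
    (Eventually.of_forall fun k =>
      (locallyIntegrable_indicator v).integrableOn_isCompact (isCompact_closedBall _ _))
    (by simp [integral_sub_left_eq_self, integral_mollifier])
    (Eventually.of_forall fun k y hy => by
      change y ∈ Metric.closedBall x (scale k)
      rw [Metric.mem_closedBall, dist_eq_norm, norm_sub_rev]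
      by_contra h
      exact hy (mollifier_eq_zero (not_le.1 h).le))
    (Eventually.of_forall fun k y => abs_mollifier_le k _ _)
  rw [Set.indicator_of_mem hxd] at h2
  refine h2.congr fun k => ?_
  rw [mollify, ← integral_indicator measurableSet_disc]
  refine integral_congr_ae (ae_of_all _ fun y => ?_)
  by_cases hy : y ∈ disc <;> simp [hy]

theorem measurable_mollify (k : ℕ) (v : L2Disc) : Measurable (mollify k v) :=
  (contDiff_mollify k v).continuous.measurable

/-- Young's inequality for a kernel of mass one: split the kernel into two square roots, apply
Cauchy–Schwarz, then Tonelli. -/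
theorem lintegral_mollify_sq_le (k : ℕ) (v : L2Disc) :
    ∫⁻ x, ‖mollify k v x‖ₑ ^ 2 ≤ ∫⁻ x in disc, ‖v x‖ₑ ^ 2 := by
  have hm : Measurable (mollifier k) := (contDiff_mollifier k).continuous.measurable
  have hv : Measurable (v : Plane → ℂ) := (Lp.stronglyMeasurable v).measurable
  have h1 : ∀ x, ‖mollify k v x‖ₑ ^ 2 ≤ ∫⁻ y in disc, ‖mollifier k (x - y)‖ₑ * ‖v y‖ₑ ^ 2 := by
    intro x
    have hφ : ∀ y, ‖mollifier k (x - y)‖ₑ = ‖Real.sqrt (mollifier k (x - y))‖ₑ ^ 2 := fun y => by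
      rw [← enorm_pow, Real.sq_sqrt (mollifier_nonneg _ _)]
    calc ‖mollify k v x‖ₑ ^ 2
        ≤ (∫⁻ y in disc, ‖mollifier k (x - y) • v y‖ₑ) ^ 2 := by
          gcongr
          exact enorm_integral_le_lintegral_enorm _
      _ = (∫⁻ y in disc, ‖Real.sqrt (mollifier k (x - y))‖ₑ *
            (‖Real.sqrt (mollifier k (x - y))‖ₑ * ‖v y‖ₑ)) ^ 2 := by
          congr 1
          refine lintegral_congr fun y => ?_
          rw [enorm_smul, hφ]
          ring
      _ ≤ (∫⁻ y in disc, ‖Real.sqrt (mollifier k (x - y))‖ₑ ^ 2) *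
            ∫⁻ y in disc, (‖Real.sqrt (mollifier k (x - y))‖ₑ * ‖v y‖ₑ) ^ 2 :=
          sq_lintegral_mul_le (by fun_prop) (by fun_prop)
      _ = (∫⁻ y in disc, ‖mollifier k (x - y)‖ₑ) *
            ∫⁻ y in disc, ‖mollifier k (x - y)‖ₑ * ‖v y‖ₑ ^ 2 := by
          simp_rw [mul_pow, hφ]
      _ ≤ _ := by
          refine mul_le_of_le_one_left bot_le ?_
          rw [← lintegral_mollifier k x]
          exact setLIntegral_le_lintegral _ _
  calc ∫⁻ x, ‖mollify k v x‖ₑ ^ 2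
      ≤ ∫⁻ x, ∫⁻ y in disc, ‖mollifier k (x - y)‖ₑ * ‖v y‖ₑ ^ 2 := lintegral_mono h1
    _ = ∫⁻ y in disc, ∫⁻ x, ‖mollifier k (x - y)‖ₑ * ‖v y‖ₑ ^ 2 :=
        lintegral_lintegral_swap (by fun_prop)
    _ = ∫⁻ x in disc, ‖v x‖ₑ ^ 2 := by
        refine lintegral_congr fun y => ?_
        rw [lintegral_mul_const _ (by fun_prop)]
        have : ∫⁻ x, ‖mollifier k (x - y)‖ₑ = 1 := by
          rw [← lintegral_mollifier k y]
          refine lintegral_congr fun x => ?_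
          rw [mollifier_radial k (norm_sub_rev x y)]
        rw [this, one_mul]

/-- The reflection exchanging x and y preserves the disc, Lebesgue measure, the mollifier and the
radial integrand. -/
theorem mollify_radial (k : ℕ) {v : L2Disc} (hv : v ∈ L2rad) {x y : Plane} (h : ‖x‖ = ‖y‖) :
    mollify k v x = mollify k v y := by
  obtain ⟨f, -, hf⟩ := hv
  have e : ∀ z, mollify k v z = ∫ t in disc, mollifier k (z - t) • f ‖t‖ := fun z =>
    integral_congr_ae (hf.mono fun t ht => by simp only [ht])
  set R := (ℝ ∙ (x - y))ᗮ.reflection with hR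
  have hRx : R x = y := Submodule.reflection_sub h
  rw [e, e, ← hRx]
  have hpre : R ⁻¹' disc = disc := by
    ext z
    simp [disc]
  rw [← R.measurePreserving.setIntegral_preimage_emb R.toHomeomorph.measurableEmbedding
    (fun t => mollifier k (R x - t) • f ‖t‖) disc, hpre]
  refine setIntegral_congr_fun measurableSet_disc fun t _ => ?_
  simp only [← map_sub, LinearIsometryEquiv.norm_map]
  rw [mollifier_radial k (R.norm_map (x - t))]

end

end RadialNLS

namespace RadialNLS

noncomputable section

/-! ### Linearity of the weak gradient -/

/-- Integration against a continuous compactly supported function, as a linear map. -/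
def testPairing (g : Plane → ℝ) (hg : Continuous g) (hc : HasCompactSupport g) :
    L2Disc →ₗ[ℝ] ℂ where
  toFun v := ∫ x in disc, g x • v x
  map_add' v w := by
    obtain ⟨C, hC⟩ := hc.exists_bound_of_continuous hg
    have hi : ∀ u : L2Disc, Integrable (fun x => g x • u x) (volume.restrict disc) := fun u =>
      (integrable_L2Disc u).bdd_smul C hg.aestronglyMeasurable (ae_of_all _ hC)
    rw [← integral_add (hi v) (hi w)]
    refine integral_congr_ae ((Lp.coeFn_add v w).mono fun x hx => ?_)
    simp only [hx, Pi.add_apply, smul_add]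
  map_smul' c v := by
    rw [RingHom.id_apply, ← integral_smul]
    refine integral_congr_ae ((Lp.coeFn_smul c v).mono fun x hx => ?_)
    simp only [hx, Pi.smul_apply]
    rw [smul_comm]

theorem testPairing_apply (g : Plane → ℝ) (hg : Continuous g) (hc : HasCompactSupport g)
    (v : L2Disc) : testPairing g hg hc v = ∫ x in disc, g x • v x := rfl

theorem HasGradientH10.sum {ι : Type*} {s : Finset ι} {h : ι → L2Disc} {G : ι → Fin 2 → L2Disc}
    (hG : ∀ i ∈ s, HasGradientH10 (h i) (G i)) (a : ι → ℝ) :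
    HasGradientH10 (∑ i ∈ s, a i • h i) fun j => ∑ i ∈ s, a i • G i j := by
  intro φ hφ hc j
  have hd : Continuous fun x => fderiv ℝ φ x (EuclideanSpace.single j 1) :=
    (hφ.continuous_fderiv (by simp)).clm_apply continuous_const
  have hdc : HasCompactSupport fun x => fderiv ℝ φ x (EuclideanSpace.single j 1) :=
    hc.fderiv_apply ℝ _
  rw [← testPairing_apply _ hd hdc, ← testPairing_apply _ hφ.continuous hc]
  simp only [map_sum, map_smul, ← Finset.sum_neg_distrib, ← smul_neg]
  refine Finset.sum_congr rfl fun i hi => ?_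
  rw [testPairing_apply, testPairing_apply, hG i hi φ hφ hc j]

theorem L2rad_sum {ι : Type*} {s : Finset ι} {h : ι → L2Disc} (hh : ∀ i ∈ s, h i ∈ L2rad)
    (a : ι → ℝ) : ∑ i ∈ s, a i • h i ∈ L2rad := by
  classical
  induction s using Finset.induction_on with
  | empty => exact ⟨0, measurable_zero, Lp.coeFn_zero ℂ 2 _⟩
  | insert i s hi ih =>
    obtain ⟨f, hfm, hf⟩ := ih fun j hj => hh j (Finset.mem_insert_of_mem hj)
    obtain ⟨g, hgm, hg⟩ := hh i (Finset.mem_insert_self i s)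
    refine ⟨fun r => a i • g r + f r, by fun_prop, ?_⟩
    rw [Finset.sum_insert hi]
    filter_upwards [hf, hg, Lp.coeFn_add (a i • h i) (∑ i ∈ s, a i • h i),
      Lp.coeFn_smul (a i) (h i)] with x h1 h2 h3 h4
    rw [h3, Pi.add_apply, h4, Pi.smul_apply, h1, h2]

theorem mollify_sum {ι : Type*} (s : Finset ι) (h : ι → L2Disc) (a : ι → ℝ) (k : ℕ) (x : Plane) :
    mollify k (∑ i ∈ s, a i • h i : L2Disc) x = ∑ i ∈ s, a i • mollify k (h i) x := by
  have hc : Continuous fun y => mollifier k (x - y) :=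
    (contDiff_mollifier k).continuous.comp (continuous_const.sub continuous_id)
  have hcc : HasCompactSupport fun y => mollifier k (x - y) :=
    (hasCompactSupport_mollifier k).comp_homeomorph (Homeomorph.subLeft x)
  unfold mollify
  rw [← testPairing_apply _ hc hcc, map_sum]
  simp only [map_smul]
  rfl

theorem enorm_sq_L2Disc (v : L2Disc) : ‖v‖ₑ ^ 2 = ∫⁻ x in disc, ‖v x‖ₑ ^ 2 := by
  have := eLpNorm_nnreal_pow_eq_lintegral (f := v) (μ := volume.restrict disc) (p := 2) two_ne_zero
  rw [Lp.enorm_def]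
  simpa using this

/-! ### Ladyzhenskaya's inequality -/

theorem enorm_sq_clm_le (L : Plane →L[ℝ] ℂ) :
    ‖L‖ₑ ^ 2 ≤ ∑ j : Fin 2, ‖L (EuclideanSpace.single j 1)‖ₑ ^ 2 := by
  simp_rw [enorm_pow_eq_ofReal]
  rw [← ENNReal.ofReal_sum_of_nonneg fun j _ => by positivity]
  refine ENNReal.ofReal_le_ofReal ?_
  have h : ‖L‖ ≤ Real.sqrt (∑ j : Fin 2, ‖L (EuclideanSpace.single j 1)‖ ^ 2) := by
    refine L.opNorm_le_bound (Real.sqrt_nonneg _) fun y => ?_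
    have hy : y = y 0 • EuclideanSpace.single 0 1 + y 1 • EuclideanSpace.single 1 1 := by
      ext i
      fin_cases i <;> simp
    have h1 : ‖L y‖ ≤ |y 0| * ‖L (EuclideanSpace.single 0 1)‖
        + |y 1| * ‖L (EuclideanSpace.single 1 1)‖ := by
      conv_lhs => rw [hy, map_add, map_smul, map_smul]
      exact (norm_add_le _ _).trans_eq (by rw [norm_smul, norm_smul]; rfl)
    rw [EuclideanSpace.norm_eq, ← Real.sqrt_mul (by positivity)]
    refine h1.trans (Real.le_sqrt_of_sq_le ?_)
    simp only [Fin.sum_univ_two, Real.norm_eq_abs]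
    nlinarith [sq_nonneg (|y 0| * ‖L (EuclideanSpace.single 1 1)‖
      - |y 1| * ‖L (EuclideanSpace.single 0 1)‖)]
  exact (pow_le_pow_left₀ (norm_nonneg _) h 2).trans_eq (Real.sq_sqrt (by positivity))

theorem lintegral_fderiv_mollify_sq_le {v : L2Disc} {G : Fin 2 → L2Disc} (hG : HasGradientH10 v G)
    (k : ℕ) : ∫⁻ x, ‖fderiv ℝ (mollify k v) x‖ₑ ^ 2 ≤ ∑ j, ‖G j‖ₑ ^ 2 := by
  calc _ ≤ ∫⁻ x, ∑ j, ‖mollify k (G j) x‖ₑ ^ 2 := by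
        refine lintegral_mono fun x => (enorm_sq_clm_le _).trans_eq ?_
        simp_rw [fderiv_mollify hG]
    _ = ∑ j, ∫⁻ x, ‖mollify k (G j) x‖ₑ ^ 2 :=
        lintegral_finsetSum _ fun j _ => (measurable_mollify k (G j)).enorm.pow_const 2
    _ ≤ _ := by
        gcongr with j
        rw [enorm_sq_L2Disc]
        exact lintegral_mollify_sq_le k (G j)

/-- The constant in Ladyzhenskaya's inequality. -/
def ladyzhenskayaConst : NNReal :=
  4 * lintegralPowLePowLIntegralFDerivConst (volume : Measure Plane) 2

/-- The Sobolev inequality bounding the L² norm by the L¹ norm of the gradient, applied to w²,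
followed by Cauchy–Schwarz on |w||∇w|. The factor 4 in the constant is the square of the 2 in ∇(w²)
= 2w∇w. -/
theorem lintegral_pow_four_le {w : Plane → ℂ} (hw : ContDiff ℝ 1 w) (hc : HasCompactSupport w) :
    ∫⁻ x, ‖w x‖ₑ ^ 4
      ≤ ladyzhenskayaConst * ((∫⁻ x, ‖w x‖ₑ ^ 2) * ∫⁻ x, ‖fderiv ℝ w x‖ₑ ^ 2) := by
  have hp : Real.HolderConjugate (Module.finrank ℝ Plane) 2 := by
    simpa using Real.HolderConjugate.two_two
  have h := lintegral_pow_le_pow_lintegral_fderiv (volume : Measure Plane) (u := w * w)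
    (hw.mul hw) hc.mul_left hp
  have hd : ∀ x, ‖fderiv ℝ (w * w) x‖ₑ ≤ 2 * (‖w x‖ₑ * ‖fderiv ℝ w x‖ₑ) := by
    intro x
    have hx := (hw.differentiable one_ne_zero x).hasFDerivAt
    rw [(hx.mul hx).fderiv, two_mul, ← enorm_smul (w x) (fderiv ℝ w x)]
    exact enorm_add_le (w x • fderiv ℝ w x) (w x • fderiv ℝ w x)
  have hm1 : Measurable fun x => ‖w x‖ₑ := hw.continuous.enorm.measurable
  have hm2 : Measurable fun x => ‖fderiv ℝ w x‖ₑ :=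
    (hw.continuous_fderiv one_ne_zero).enorm.measurable
  calc ∫⁻ x, ‖w x‖ₑ ^ 4 = ∫⁻ x, ‖(w * w) x‖ₑ ^ (2 : ℝ) := by
        refine lintegral_congr fun x => ?_
        rw [Pi.mul_apply, enorm_mul, ENNReal.rpow_two]
        ring
    _ ≤ _ := h
    _ ≤ lintegralPowLePowLIntegralFDerivConst (volume : Measure Plane) 2 *
          (∫⁻ x, 2 * (‖w x‖ₑ * ‖fderiv ℝ w x‖ₑ)) ^ (2 : ℝ) := by
        gcongr with x
        exact hd x
    _ = ladyzhenskayaConst * (∫⁻ x, ‖w x‖ₑ * ‖fderiv ℝ w x‖ₑ) ^ 2 := by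
        rw [lintegral_const_mul _ (by fun_prop), ENNReal.rpow_two, ladyzhenskayaConst, mul_pow]
        push_cast
        ring
    _ ≤ _ := by
        gcongr
        exact sq_lintegral_mul_le hm1.aemeasurable hm2.aemeasurable

/-- Ladyzhenskaya's inequality on `H¹₀(𝔻)`. -/
theorem ladyzhenskaya {v : L2Disc} {G : Fin 2 → L2Disc} (hG : HasGradientH10 v G) :
    ∫⁻ x in disc, ‖v x‖ₑ ^ 4 ≤ ladyzhenskayaConst * (‖v‖ₑ ^ 2 * ∑ j, ‖G j‖ₑ ^ 2) := by
  calc ∫⁻ x in disc, ‖v x‖ₑ ^ 4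
      ≤ ∫⁻ x in disc, liminf (fun k => ‖mollify k v x‖ₑ ^ 4) atTop := by
        refine lintegral_mono_ae ((ae_tendsto_mollify v).mono fun x hx => ?_)
        exact (((ENNReal.continuous_pow 4).tendsto _).comp hx.enorm).liminf_eq.ge
    _ ≤ liminf (fun k => ∫⁻ x in disc, ‖mollify k v x‖ₑ ^ 4) atTop :=
        lintegral_liminf_le fun k => (measurable_mollify k v).enorm.pow_const 4
    _ ≤ _ := by
        refine liminf_le_of_le (by isBoundedDefault) fun b hb => ?_
        obtain ⟨k, hk⟩ := hb.exists
        refine hk.trans ((setLIntegral_le_lintegral _ _).trans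
          ((lintegral_pow_four_le ((contDiff_mollify k v).of_le (by simp))
            (hasCompactSupport_mollify k v)).trans ?_))
        gcongr
        · rw [enorm_sq_L2Disc]
          exact lintegral_mollify_sq_le k v
        · exact lintegral_fderiv_mollify_sq_le hG k

/-! ### Pointwise bounds for radial functions -/

/-- The area of the unit disc. -/
def discArea : ℝ := volume.real (Metric.ball (0 : Plane) 1)

theorem discArea_pos : 0 < discArea :=
  ENNReal.toReal_pos (Metric.measure_ball_pos _ _ one_pos).ne' measure_ball_lt_top.ne

/-- The weight in the pointwise bound for radial functions of `H¹₀(𝔻)`. -/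
def radialWeight (x : Plane) : ℝ := Real.sqrt (2 / ‖x‖) / discArea

theorem radialWeight_nonneg (x : Plane) : 0 ≤ radialWeight x :=
  div_nonneg (Real.sqrt_nonneg _) discArea_pos.le

/-- The integral is log(2/r), and log t ≤ 2√t. This crude bound suffices because the square of the
resulting weight is still only of order 1/|x|. -/
theorem lintegral_inv_Ioc_le {r : ℝ} (hr : 0 < r) (hr2 : r ≤ 2) :
    ∫⁻ s in Set.Ioc r 2, ENNReal.ofReal s⁻¹ ≤ ENNReal.ofReal (2 * Real.sqrt (2 / r)) := by
  have hint : IntegrableOn (fun s : ℝ => s⁻¹) (Set.Ioc r 2) := by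
    rw [← intervalIntegrable_iff_integrableOn_Ioc_of_le hr2]
    refine intervalIntegral.intervalIntegrable_inv (fun s hs => ?_) continuousOn_id
    rw [Set.uIcc_of_le hr2] at hs
    exact (hr.trans_le hs.1).ne'
  rw [← ofReal_integral_eq_lintegral_ofReal hint]
  · refine ENNReal.ofReal_le_ofReal ?_
    rw [← intervalIntegral.integral_of_le hr2, integral_inv_of_pos hr two_pos]
    have := Real.log_le_rpow_div (x := 2 / r) (by positivity) (ε := 1 / 2) (by norm_num)
    rw [← Real.sqrt_eq_rpow] at this
    linarith
  · filter_upwards [ae_restrict_mem measurableSet_Ioc] with s hs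
    exact inv_nonneg.2 (hr.trans hs.1).le

/-- Write W(x) as the integral of the radial derivative p' from |x| to 2, and apply Cauchy–Schwarz
with weight s: the factor ∫ds/s gives the weight, and ∫s|p'|²ds is controlled by the Dirichlet
energy in polar coordinates. The radius 2 contains the supports of all the mollified functions. -/
theorem enorm_sq_le_of_radial {W : Plane → ℂ} (hW : ContDiff ℝ 1 W) (hc : HasCompactSupport W)
    (hrad : ∀ x y, ‖x‖ = ‖y‖ → W x = W y) (h0 : ∀ x, 2 ≤ ‖x‖ → W x = 0) {x : Plane} (hx : x ≠ 0) :
    ‖W x‖ₑ ^ 2 ≤ ENNReal.ofReal (radialWeight x) * ∫⁻ y, ‖fderiv ℝ W y‖ₑ ^ 2 := by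
  rcases le_or_gt 2 ‖x‖ with hx2 | hx2
  · simp [h0 x hx2]
  set e : Plane := EuclideanSpace.single 0 1 with he
  have hen : ‖e‖ = 1 := by simp [he]
  set p' : ℝ → ℂ := fun s => fderiv ℝ W (s • e) e with hp'
  have hp'c : Continuous p' := ((hW.continuous_fderiv one_ne_zero).comp
    (continuous_id.smul continuous_const)).clm_apply continuous_const
  have hderiv : ∀ (u : Plane) (s : ℝ), HasDerivAt (fun t : ℝ => W (t • u)) (fderiv ℝ W (s • u) u) s := by
    intro u s
    have h1 := (hW.differentiable one_ne_zero (s • u)).hasFDerivAt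
    have h2 : HasDerivAt (fun t : ℝ => t • u) u s := by
      simpa using (hasDerivAt_id s).smul_const u
    exact h1.comp_hasDerivAt s h2
  -- By radial symmetry p' at |y| is also the derivative of W at y along y/|y|, hence at most the
  -- norm of the full gradient there.
  have hle : ∀ y : Plane, y ≠ 0 → ‖p' ‖y‖‖ ≤ ‖fderiv ℝ W y‖ := by
    intro y hy
    have hy' : ‖y‖ ≠ 0 := norm_ne_zero_iff.2 hy
    set u := ‖y‖⁻¹ • y with hu
    have hun : ‖u‖ = 1 := by rw [hu, norm_smul, norm_inv, norm_norm, inv_mul_cancel₀ hy']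
    have hyu : ‖y‖ • u = y := smul_inv_smul₀ hy' y
    have hfun : (fun t : ℝ => W (t • e)) = fun t : ℝ => W (t • u) := by
      ext t
      exact hrad _ _ (by rw [norm_smul, norm_smul, hen, hun])
    have h1 := hderiv e ‖y‖
    rw [hfun] at h1
    have h2 := h1.unique (hderiv u ‖y‖)
    simp only [hp', h2, hyu]
    exact (ContinuousLinearMap.le_opNorm _ _).trans_eq (by rw [hun, mul_one])
  have hr : 0 < ‖x‖ := norm_pos_iff.2 hx
  set r := ‖x‖ with hrdef
  have hWx : W x = W (r • e) := hrad _ _ (by rw [norm_smul, hen]; simp [hrdef])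
  have hftc : ∫ s in r..2, p' s = -W x := by
    rw [intervalIntegral.integral_eq_sub_of_hasDerivAt (fun s _ => hderiv e s)
      (hp'c.intervalIntegrable _ _), h0 ((2 : ℝ) • e) (by rw [norm_smul, hen]; simp), hWx, zero_sub]
  have hbound : ‖W x‖ₑ ≤ ∫⁻ s in Set.Ioc r 2, ‖p' s‖ₑ := by
    rw [← enorm_neg, ← hftc, intervalIntegral.integral_of_le hx2.le]
    exact enorm_integral_le_lintegral_enorm _
  have hgrad : ∫⁻ s in Set.Ioi (0 : ℝ), ENNReal.ofReal (s * ‖p' s‖ ^ 2)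
      ≤ ENNReal.ofReal (2 * discArea)⁻¹ * ∫⁻ y, ‖fderiv ℝ W y‖ₑ ^ 2 := by
    have hFc : HasCompactSupport fun y => ‖fderiv ℝ W y‖ ^ 2 :=
      (hc.fderiv ℝ).comp_left (g := fun L => ‖L‖ ^ 2) (by simp)
    have hFi : Integrable fun y => ‖fderiv ℝ W y‖ ^ 2 :=
      ((hW.continuous_fderiv one_ne_zero).norm.pow 2).integrable_of_hasCompactSupport hFc
    have hae : ∀ᵐ y : Plane, ‖p' ‖y‖‖ ^ 2 ≤ ‖fderiv ℝ W y‖ ^ 2 := by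
      filter_upwards [compl_mem_ae_iff.2 (measure_singleton (0 : Plane))] with y hy
      exact pow_le_pow_left₀ (norm_nonneg _) (hle y hy) 2
    have hpi : Integrable fun y : Plane => ‖p' ‖y‖‖ ^ 2 := by
      refine hFi.mono' (Continuous.aestronglyMeasurable (by fun_prop)) ?_
      filter_upwards [hae] with y hy
      rwa [Real.norm_of_nonneg (by positivity)]
    have hpi' := (integrable_fun_norm_addHaar volume (f := fun s => ‖p' s‖ ^ 2)).1 hpi
    have heq := integral_fun_norm_addHaar (volume : Measure Plane) (fun s => ‖p' s‖ ^ 2)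
    simp only [finrank_euclideanSpace, Fintype.card_fin, Nat.add_one_sub_one, pow_one, smul_eq_mul,
      nsmul_eq_mul, Nat.cast_ofNat] at heq hpi'
    rw [← ofReal_integral_eq_lintegral_ofReal hpi']
    · simp_rw [enorm_pow_eq_ofReal]
      rw [← ofReal_integral_eq_lintegral_ofReal hFi (ae_of_all _ fun y => by positivity),
        ← ENNReal.ofReal_mul (by have := discArea_pos; positivity)]
      refine ENNReal.ofReal_le_ofReal ?_
      rw [← div_eq_inv_mul, le_div_iff₀ (by have := discArea_pos; positivity)]
      calc _ = ∫ y : Plane, ‖p' ‖y‖‖ ^ 2 := by rw [heq, discArea]; ring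
        _ ≤ _ := integral_mono_ae hpi hFi hae
    · filter_upwards [ae_restrict_mem measurableSet_Ioi] with s hs
      exact mul_nonneg (le_of_lt hs) (sq_nonneg _)
  calc ‖W x‖ₑ ^ 2 ≤ (∫⁻ s in Set.Ioc r 2, ‖p' s‖ₑ) ^ 2 := by gcongr
    _ = (∫⁻ s in Set.Ioc r 2, ENNReal.ofReal (Real.sqrt s⁻¹) *
          ENNReal.ofReal (Real.sqrt s * ‖p' s‖)) ^ 2 := by
        congr 1
        refine setLIntegral_congr_fun measurableSet_Ioc fun s hs => ?_
        have hs0 : 0 < s := hr.trans hs.1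
        rw [← ENNReal.ofReal_mul (Real.sqrt_nonneg _), ← mul_assoc, Real.sqrt_inv,
          inv_mul_cancel₀ (Real.sqrt_pos.2 hs0).ne', one_mul, ofReal_norm]
    _ ≤ (∫⁻ s in Set.Ioc r 2, ENNReal.ofReal (Real.sqrt s⁻¹) ^ 2) *
          ∫⁻ s in Set.Ioc r 2, ENNReal.ofReal (Real.sqrt s * ‖p' s‖) ^ 2 :=
        sq_lintegral_mul_le (by fun_prop) (by fun_prop)
    _ = (∫⁻ s in Set.Ioc r 2, ENNReal.ofReal s⁻¹) *
          ∫⁻ s in Set.Ioc r 2, ENNReal.ofReal (s * ‖p' s‖ ^ 2) := by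
        congr 1 <;> refine setLIntegral_congr_fun measurableSet_Ioc fun s hs => ?_
        all_goals
          have hs0 : 0 < s := hr.trans hs.1
          rw [← ENNReal.ofReal_pow (by positivity)]
        · rw [Real.sq_sqrt (by positivity)]
        · rw [mul_pow, Real.sq_sqrt hs0.le]
    _ ≤ ENNReal.ofReal (2 * Real.sqrt (2 / r)) *
          (ENNReal.ofReal (2 * discArea)⁻¹ * ∫⁻ y, ‖fderiv ℝ W y‖ₑ ^ 2) := by
        gcongr
        · exact lintegral_inv_Ioc_le hr hx2.le
        · refine le_trans (lintegral_mono_set fun s hs => ?_) hgrad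
          exact hr.trans hs.1
    _ = _ := by
        rw [← mul_assoc, ← ENNReal.ofReal_mul (by positivity)]
        congr 2
        rw [radialWeight, ← hrdef]
        have := discArea_pos
        field_simp

theorem enorm_sq_mollify_le {v : L2Disc} (hv : v ∈ L2rad) {G : Fin 2 → L2Disc}
    (hG : HasGradientH10 v G) (k : ℕ) {x : Plane} (hx : x ≠ 0) :
    ‖mollify k v x‖ₑ ^ 2 ≤ ENNReal.ofReal (radialWeight x) * ∑ j, ‖G j‖ₑ ^ 2 := by
  refine (enorm_sq_le_of_radial ((contDiff_mollify k v).of_le (by simp))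
    (hasCompactSupport_mollify k v) (fun _ _ => mollify_radial k hv)
    (fun _ => mollify_eq_zero v) hx).trans ?_
  gcongr
  exact lintegral_fderiv_mollify_sq_le hG k

/-- The squared weight is a multiple of 1/|x|, and the Jacobian s of polar coordinates cancels the
singularity. -/
theorem lintegral_radialWeight_sq_lt_top :
    ∫⁻ x in disc, ENNReal.ofReal (radialWeight x) ^ 2 < ⊤ := by
  have hi : IntegrableOn (fun x : Plane => 2 / ‖x‖ / discArea ^ 2) (Metric.ball (0 : Plane) 1) := by
    refine (integrableOn_fun_norm_addHaar volume (f := fun s => 2 / s / discArea ^ 2)).2 ?_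
    refine (integrableOn_const (C := 2 / discArea ^ 2) (by simp)).congr_fun (fun s hs => ?_)
      measurableSet_Ioo
    have := hs.1.ne'
    simp only [finrank_euclideanSpace, Fintype.card_fin, Nat.add_one_sub_one, pow_one, smul_eq_mul]
    field_simp
  refine lt_of_eq_of_lt ?_ hi.lintegral_lt_top
  refine lintegral_congr fun x => ?_
  rw [← ENNReal.ofReal_pow (radialWeight_nonneg x), radialWeight, div_pow,
    Real.sq_sqrt (by positivity)]

theorem lintegral_radialWeight_lt_top :
    ∫⁻ x in disc, ENNReal.ofReal (radialWeight x) < ⊤ := by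
  refine lt_of_le_of_lt (lintegral_mono (g := fun x => 1 + ENNReal.ofReal (radialWeight x) ^ 2)
    fun x => ?_) ?_
  · rcases le_total (ENNReal.ofReal (radialWeight x)) 1 with h | h
    · exact h.trans le_self_add
    · exact (le_self_pow₀ h two_ne_zero).trans le_add_self
  · rw [lintegral_add_left measurable_const]
    exact ENNReal.add_lt_top.2 ⟨by simp [disc], lintegral_radialWeight_sq_lt_top⟩

end

end RadialNLS

namespace RadialNLS

noncomputable section

/-! ### The quartic functional -/

/-- The quartic functional `∫_𝔻 |v|⁴`. -/
def quartic (v : L2Disc) : ℝ≥0∞ := ∫⁻ x in disc, ‖v x‖ₑ ^ 4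

/-- An L²-convergent sequence has an almost everywhere convergent subsequence, to which Fatou's
lemma applies. -/
theorem lowerSemicontinuous_quartic : LowerSemicontinuous quartic := by
  refine lowerSemicontinuous_iff_isClosed_preimage.2 fun c => IsSeqClosed.isClosed ?_
  intro u v hu huv
  obtain ⟨ns, -, hns⟩ := (tendstoInMeasure_of_tendsto_Lp huv).exists_seq_tendsto_ae
  calc quartic v ≤ ∫⁻ x in disc, liminf (fun k => ‖u (ns k) x‖ₑ ^ 4) atTop :=
        lintegral_mono_ae (hns.mono fun x hx =>
          (((ENNReal.continuous_pow 4).tendsto _).comp hx.enorm).liminf_eq.ge)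
    _ ≤ liminf (fun k => ∫⁻ x in disc, ‖u (ns k) x‖ₑ ^ 4) atTop :=
        lintegral_liminf_le fun k => (Lp.stronglyMeasurable (u (ns k))).measurable.enorm.pow_const 4
    _ ≤ c := by
        refine liminf_le_of_le (by isBoundedDefault) fun b hb => ?_
        obtain ⟨k, hk⟩ := hb.exists
        exact hk.trans (hu (ns k))

theorem enorm_add_pow_four_le (a b : ℂ) : ‖a + b‖ₑ ^ 4 ≤ 8 * (‖a‖ₑ ^ 4 + ‖b‖ₑ ^ 4) := by
  calc ‖a + b‖ₑ ^ 4 ≤ ENNReal.ofReal (8 * (‖a‖ ^ 4 + ‖b‖ ^ 4)) := by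
        rw [enorm_pow_eq_ofReal]
        refine ENNReal.ofReal_le_ofReal ?_
        have := add_pow_le (norm_nonneg a) (norm_nonneg b) 4
        norm_num at this
        exact (pow_le_pow_left₀ (norm_nonneg _) (norm_add_le a b) 4).trans this
    _ = _ := by
        rw [ENNReal.ofReal_mul (by norm_num), ENNReal.ofReal_add (by positivity) (by positivity),
          enorm_pow_eq_ofReal, enorm_pow_eq_ofReal]
        norm_num

theorem quartic_add_le (u v : L2Disc) : quartic (u + v) ≤ 8 * (quartic u + quartic v) := by
  have hm : ∀ w : L2Disc, Measurable fun x => ‖w x‖ₑ ^ 4 := fun w =>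
    (Lp.stronglyMeasurable w).measurable.enorm.pow_const 4
  unfold quartic
  rw [← lintegral_add_left (hm u), ← lintegral_const_mul' _ _ (by simp)]
  refine lintegral_mono_ae ((Lp.coeFn_add u v).mono fun x hx => ?_)
  rw [hx]
  exact enorm_add_pow_four_le _ _

theorem quarticExp_eq (C : ℝ) (v : L2Disc) :
    quarticExp C v = EReal.exp ((ENNReal.ofReal C * quartic v : ℝ≥0∞) : EReal) := rfl

theorem lowerSemicontinuous_quarticExp (C : ℝ) : LowerSemicontinuous (quarticExp C) := by
  have hc : Continuous fun q : ℝ≥0∞ => EReal.exp ((ENNReal.ofReal C * q : ℝ≥0∞) : EReal) :=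
    EReal.expOrderIso.continuous.comp (continuous_coe_ennreal_ereal.comp
      (ENNReal.continuous_const_mul ENNReal.ofReal_ne_top))
  refine hc.comp_lowerSemicontinuous lowerSemicontinuous_quartic fun p q hpq => ?_
  exact EReal.exp_monotone (EReal.coe_ennreal_le_coe_ennreal_iff.2 (mul_le_mul_right hpq _))

theorem quarticExp_le {C : ℝ} (hC : 0 ≤ C) {v : L2Disc} {q : ℝ} (hq : 0 ≤ q)
    (hv : quartic v ≤ ENNReal.ofReal q) :
    quarticExp C v ≤ ENNReal.ofReal (Real.exp (C * q)) := by
  rw [quarticExp_eq]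
  calc _ ≤ EReal.exp ((ENNReal.ofReal (C * q) : ℝ≥0∞) : EReal) := by
        refine EReal.exp_monotone (EReal.coe_ennreal_le_coe_ennreal_iff.2 ?_)
        rw [ENNReal.ofReal_mul hC]
        gcongr
    _ = _ := by
        rw [EReal.coe_ennreal_ofReal, max_eq_left (mul_nonneg hC hq), EReal.exp_coe]

/-! ### Dirichlet-orthonormal radial families -/

/-- A sequence in `H¹_{rad,0}(𝔻)` which is orthonormal for the Dirichlet inner product. -/
structure IsDirichletOrthonormal (h : ℕ → L2Disc) : Prop where
  mem : ∀ n, h n ∈ H10rad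
  orthonormal : ∀ m n, dirichletInner (h m) (h n) = if m = n then 1 else 0

theorem IsDirichletBasis.isDirichletOrthonormal {V : Set L2Disc} {h : ℕ → L2Disc}
    (hh : IsDirichletBasis V h) : IsDirichletOrthonormal h :=
  ⟨fun n => (hh.mem n).2, hh.orthonormal⟩

namespace IsDirichletOrthonormal

variable {h : ℕ → L2Disc}

theorem hasGradient (hh : IsDirichletOrthonormal h) (n : ℕ) :
    HasGradientH10 (h n) (gradient (h n)) := by
  have := (hh.mem n).2
  unfold gradient
  rw [dif_pos this]
  exact this.choose_spec

/-- Orthonormality identifies the Euclidean norm of the coefficients with the Dirichlet norm, so the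
Gaussian cost |x − y|² is an energy. -/
theorem energy_sum (hh : IsDirichletOrthonormal h) (s : Finset ℕ) (a : ℕ → ℝ) :
    ∑ j, ‖∑ n ∈ s, a n • gradient (h n) j‖ₑ ^ 2 = ENNReal.ofReal (∑ n ∈ s, a n ^ 2) := by
  simp_rw [enorm_pow_eq_ofReal]
  rw [← ENNReal.ofReal_sum_of_nonneg fun j _ => by positivity]
  congr 1
  calc ∑ j, ‖∑ n ∈ s, a n • gradient (h n) j‖ ^ 2
      = ∑ j, ∑ m ∈ s, ∑ n ∈ s, a m * (a n * inner ℝ (gradient (h m) j) (gradient (h n) j)) := by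
        refine Finset.sum_congr rfl fun j _ => ?_
        rw [← real_inner_self_eq_norm_sq, sum_inner]
        refine Finset.sum_congr rfl fun m _ => ?_
        rw [inner_sum]
        refine Finset.sum_congr rfl fun n _ => ?_
        rw [real_inner_smul_left, real_inner_smul_right]
    _ = ∑ m ∈ s, ∑ n ∈ s, a m * (a n * dirichletInner (h m) (h n)) := by
        rw [Finset.sum_comm]
        refine Finset.sum_congr rfl fun m _ => ?_
        rw [Finset.sum_comm]
        refine Finset.sum_congr rfl fun n _ => ?_
        rw [dirichletInner, Finset.mul_sum, Finset.mul_sum]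
    _ = _ := by
        simp only [hh.orthonormal]
        refine Finset.sum_congr rfl fun m hm => ?_
        simp [hm, sq]

theorem quartic_sum_le (hh : IsDirichletOrthonormal h) (s : Finset ℕ) (a : ℕ → ℝ) :
    quartic (∑ n ∈ s, a n • h n)
      ≤ ladyzhenskayaConst * (‖∑ n ∈ s, a n • h n‖ₑ ^ 2 * ENNReal.ofReal (∑ n ∈ s, a n ^ 2)) := by
  rw [← hh.energy_sum s a]
  exact ladyzhenskaya (HasGradientH10.sum (fun n _ => hh.hasGradient n) a)

/-- Duality: point evaluation is bounded by the square root of the weight on the unit energy ball.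
Testing with coefficients a = Re w gives R² ≤ weight · R for R = ∑(Re w)², hence R ≤ weight; the
imaginary parts are treated likewise, whence the factor 2. -/
theorem sum_enorm_sq_mollify_le (hh : IsDirichletOrthonormal h) (s : Finset ℕ) (k : ℕ) {x : Plane}
    (hx : x ≠ 0) :
    ∑ n ∈ s, ‖mollify k (h n) x‖ₑ ^ 2 ≤ 2 * ENNReal.ofReal (radialWeight x) := by
  set w : ℕ → ℂ := fun n => mollify k (h n) x with hw
  have hW := radialWeight_nonneg x
  have key : ∀ a : ℕ → ℝ, ‖∑ n ∈ s, a n • w n‖ ^ 2 ≤ radialWeight x * ∑ n ∈ s, a n ^ 2 := by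
    intro a
    have := enorm_sq_mollify_le (L2rad_sum (fun n (_ : n ∈ s) => (hh.mem n).1) a)
      (HasGradientH10.sum (fun n _ => hh.hasGradient n) a) k hx
    rw [hh.energy_sum, mollify_sum, ← ENNReal.ofReal_mul hW, enorm_pow_eq_ofReal,
      ENNReal.ofReal_le_ofReal_iff (mul_nonneg hW (Finset.sum_nonneg fun _ _ => sq_nonneg _))] at this
    exact this
  have aux : ∀ R : ℝ, 0 ≤ R → R ^ 2 ≤ radialWeight x * R → R ≤ radialWeight x := by
    intro R hR hR2
    rcases hR.eq_or_lt with h0 | h0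
    · rwa [← h0]
    · nlinarith
  have hre : ∑ n ∈ s, (w n).re ^ 2 ≤ radialWeight x := by
    refine aux _ (Finset.sum_nonneg fun _ _ => sq_nonneg _) (le_trans ?_ (key fun n => (w n).re))
    have : (∑ n ∈ s, (w n).re • w n).re = ∑ n ∈ s, (w n).re ^ 2 := by
      simp [Complex.re_sum, sq]
    rw [← this, ← sq_abs]
    exact pow_le_pow_left₀ (abs_nonneg _) (Complex.abs_re_le_norm _) 2
  have him : ∑ n ∈ s, (w n).im ^ 2 ≤ radialWeight x := by
    refine aux _ (Finset.sum_nonneg fun _ _ => sq_nonneg _) (le_trans ?_ (key fun n => (w n).im))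
    have : (∑ n ∈ s, (w n).im • w n).im = ∑ n ∈ s, (w n).im ^ 2 := by
      simp [Complex.im_sum, sq]
    rw [← this, ← sq_abs]
    exact pow_le_pow_left₀ (abs_nonneg _) (Complex.abs_im_le_norm _) 2
  have h2 : 2 * ENNReal.ofReal (radialWeight x) = ENNReal.ofReal (2 * radialWeight x) := by
    rw [ENNReal.ofReal_mul zero_le_two, ENNReal.ofReal_ofNat]
  rw [h2]
  simp_rw [enorm_pow_eq_ofReal]
  rw [← ENNReal.ofReal_sum_of_nonneg fun j _ => by positivity]
  refine ENNReal.ofReal_le_ofReal ?_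
  have e : ∀ n, ‖mollify k (h n) x‖ ^ 2 = (w n).re ^ 2 + (w n).im ^ 2 := fun n => by
    rw [Complex.sq_norm, Complex.normSq_apply]
    ring
  simp_rw [e, Finset.sum_add_distrib]
  linarith

theorem ae_sum_enorm_sq_le (hh : IsDirichletOrthonormal h) (s : Finset ℕ) :
    ∀ᵐ x ∂(volume.restrict disc),
      ∑ n ∈ s, ‖h n x‖ₑ ^ 2 ≤ 2 * ENNReal.ofReal (radialWeight x) := by
  have h0 : ∀ᵐ x ∂((volume : Measure Plane).restrict disc), x ≠ 0 :=
    ae_restrict_of_ae (compl_mem_ae_iff.2 (measure_singleton (0 : Plane)))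
  filter_upwards [h0, ae_all_iff.2 fun n => ae_tendsto_mollify (h n)] with x hx hlim
  have hsum : Tendsto (fun k => ∑ n ∈ s, ‖mollify k (h n) x‖ₑ ^ 2) atTop
      (𝓝 (∑ n ∈ s, ‖h n x‖ₑ ^ 2)) :=
    tendsto_finsetSum s fun n _ => ((ENNReal.continuous_pow 2).tendsto _).comp (hlim n).enorm
  exact le_of_tendsto' hsum fun k => hh.sum_enorm_sq_mollify_le s k hx

theorem tsum_enorm_sq_ne_top (hh : IsDirichletOrthonormal h) : ∑' n, ‖h n‖ₑ ^ 2 ≠ ⊤ := by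
  refine ne_top_of_le_ne_top (b := 2 * ∫⁻ x in disc, ENNReal.ofReal (radialWeight x))
    (ENNReal.mul_ne_top (by simp) lintegral_radialWeight_lt_top.ne) ?_
  rw [ENNReal.tsum_eq_iSup_sum]
  refine iSup_le fun s => ?_
  simp_rw [enorm_sq_L2Disc]
  rw [← lintegral_finsetSum _ fun n _ =>
    (Lp.stronglyMeasurable (h n)).measurable.enorm.pow_const 2, ← lintegral_const_mul' _ _ (by simp)]
  exact lintegral_mono_ae (hh.ae_sum_enorm_sq_le s)

theorem _root_.RadialNLS.coeFn_finset_sum_L2Disc {ι : Type*} (s : Finset ι) (f : ι → L2Disc) :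
    ∀ᵐ x ∂(volume.restrict disc), (∑ i ∈ s, f i : L2Disc) x = ∑ i ∈ s, f i x := by
  classical
  induction s using Finset.induction_on with
  | empty => exact Lp.coeFn_zero ℂ 2 _
  | insert i s hi ih =>
    rw [Finset.sum_insert hi]
    filter_upwards [ih, Lp.coeFn_add (f i) (∑ i ∈ s, f i)] with x h1 h2
    rw [h2, Pi.add_apply, h1, Finset.sum_insert hi]

/-- A bound for the expected quartic functional of Gaussian sums. -/
def quarticBound : ℝ≥0∞ :=
  (ENNReal.ofReal fourthMomentConst * 2) ^ 2 * ∫⁻ x in disc, ENNReal.ofReal (radialWeight x) ^ 2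

theorem quarticBound_ne_top : quarticBound ≠ ⊤ :=
  ENNReal.mul_ne_top (by finiteness) lintegral_radialWeight_sq_lt_top.ne

/-- At fixed x the sum is a complex Gaussian whose fourth moment is controlled by (∑|hₙ(x)|²)²,
hence by the squared weight; Tonelli then integrates this over the disc. -/
theorem lintegral_quartic_le (hh : IsDirichletOrthonormal h) (m n : ℕ) :
    ∫⁻ y, quartic (∑ i : Fin n, y i • h (m + i)) ∂stdGaussianPi n ≤ quarticBound := by
  have hm : ∀ k, Measurable (h k : Plane → ℂ) := fun k => (Lp.stronglyMeasurable (h k)).measurable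
  have e : ∀ y : Fin n → ℝ, quartic (∑ i : Fin n, y i • h (m + i))
      = ∫⁻ x in disc, ‖∑ i : Fin n, y i • h (m + i) x‖ₑ ^ 4 := by
    intro y
    have h1 : ∀ᵐ x ∂(volume.restrict disc), ∀ i : Fin n,
        (y i • h (m + i) : L2Disc) x = y i • h (m + i) x :=
      ae_all_iff.2 fun i => Lp.coeFn_smul (y i) (h (m + i))
    refine lintegral_congr_ae ?_
    filter_upwards [h1, coeFn_finset_sum_L2Disc Finset.univ fun i : Fin n => y i • h (m + i)]
      with x hx hx'
    rw [hx']
    simp_rw [hx]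
  have hs : ∀ᵐ x ∂(volume.restrict disc),
      ∑ i : Fin n, ‖h (m + i) x‖ₑ ^ 2 ≤ 2 * ENNReal.ofReal (radialWeight x) := by
    filter_upwards [hh.ae_sum_enorm_sq_le ((Finset.range n).map (addLeftEmbedding m))] with x hx
    rw [Finset.sum_map] at hx
    rw [Fin.sum_univ_eq_sum_range fun i => ‖h (m + i) x‖ₑ ^ 2]
    exact hx
  simp_rw [e]
  rw [lintegral_lintegral_swap (by fun_prop)]
  calc ∫⁻ x in disc, ∫⁻ y, ‖∑ i : Fin n, y i • h (m + i) x‖ₑ ^ 4 ∂stdGaussianPi n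
      ≤ ∫⁻ x in disc, (ENNReal.ofReal fourthMomentConst * 2) ^ 2
          * ENNReal.ofReal (radialWeight x) ^ 2 := by
        refine lintegral_mono_ae (hs.mono fun x hx => ?_)
        have := lintegral_enorm_add_sum_pow_four_le (0 : ℂ) fun i : Fin n => h (m + i) x
        simp only [zero_add, enorm_zero, ne_eq, OfNat.ofNat_ne_zero, not_false_eq_true,
          zero_pow] at this
        refine this.trans ?_
        rw [← mul_pow, mul_assoc]
        gcongr
    _ = _ := lintegral_const_mul' _ _ (by finiteness)

end IsDirichletOrthonormal

end

end RadialNLS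

namespace RadialNLS

noncomputable section

/-! ### Independence of the blocks of a Gaussian sequence -/

theorem indepFun_gaussianSequence (m n : ℕ) :
    IndepFun (fun (g : ℕ → ℝ) (i : Fin m) => g (0 + i)) (fun (g : ℕ → ℝ) (i : Fin n) => g (m + i))
      gaussianSequence := by
  have hi : iIndepFun (fun (i : ℕ) (g : ℕ → ℝ) => g i) gaussianSequence :=
    iIndepFun_infinitePi (P := fun _ : ℕ => gaussianReal 0 1) (X := fun _ t => t)
      fun _ => measurable_id
  have hd : Disjoint (Finset.range m) (Finset.Ico m (m + n)) := by
    rw [Finset.disjoint_left]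
    intro i hi hi'
    simp only [Finset.mem_range, Finset.mem_Ico] at hi hi'
    omega
  have h := hi.indepFun_finset _ _ hd fun i => measurable_pi_apply i
  exact h.comp
    (φ := fun (z : Finset.range m → ℝ) (i : Fin m) => z ⟨0 + i, by simp⟩)
    (ψ := fun (z : Finset.Ico m (m + n) → ℝ) (i : Fin n) => z ⟨m + i, by simp⟩)
    (by fun_prop) (by fun_prop)

/-- Both factors are realized as laws of disjoint, hence independent, blocks of a single Gaussian
sequence. -/
theorem stdGaussianPi_mul_le {m n : ℕ} {A : Set (Fin m → ℝ)} {B : Set (Fin n → ℝ)}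
    {E : Set (Fin (m + n) → ℝ)} (hA : MeasurableSet A) (hB : MeasurableSet B)
    (h : ∀ y : Fin (m + n) → ℝ, (fun i => y (Fin.castAdd n i)) ∈ A →
      (fun i => y (Fin.natAdd m i)) ∈ B → y ∈ E) :
    stdGaussianPi m A * stdGaussianPi n B ≤ stdGaussianPi (m + n) E := by
  rw [← map_gaussianSequence 0 m, ← map_gaussianSequence m n, ← map_gaussianSequence 0 (m + n),
    Measure.map_apply (measurable_shift 0 m) hA, Measure.map_apply (measurable_shift m n) hB,
    ← (indepFun_gaussianSequence m n).measure_inter_preimage_eq_mul _ _ hA hB]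
  refine le_trans (measure_mono fun g hg => ?_)
    (Measure.le_map_apply (measurable_shift 0 (m + n)).aemeasurable _)
  refine h _ hg.1 ?_
  have := hg.2
  simpa using this

theorem stdGaussianPi_cube_pos (m : ℕ) {η : ℝ} (hη : 0 < η) :
    stdGaussianPi m (Set.pi Set.univ fun _ => Set.Icc (-η) η) ≠ 0 := by
  rw [Measure.pi_pi, Finset.prod_ne_zero_iff]
  intro _ _ h0
  have := gaussianReal_absolutelyContinuous' 0 one_ne_zero h0
  rw [Real.volume_Icc, ENNReal.ofReal_eq_zero] at this
  linarith

/-! ### Small-ball probabilities and exponential integrability -/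

namespace IsDirichletOrthonormal

variable {h : ℕ → L2Disc}

theorem quartic_fin_sum_le (hh : IsDirichletOrthonormal h) {n : ℕ} (y : Fin n → ℝ) :
    quartic (∑ i : Fin n, y i • h i) ≤ ladyzhenskayaConst *
      (‖∑ i : Fin n, y i • h i‖ₑ ^ 2 * ENNReal.ofReal (∑ i : Fin n, y i ^ 2)) := by
  have := hh.quartic_sum_le (Finset.range n) fun k => if hk : k < n then y ⟨k, hk⟩ else 0
  simpa [Finset.sum_range] using this

theorem measurableSet_ball_quartic {n : ℕ} (f : Fin n → L2Disc) (a b : ℝ≥0∞) :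
    MeasurableSet {y : Fin n → ℝ |
      ‖∑ i, y i • f i‖ₑ ^ 2 ≤ a ∧ quartic (∑ i, y i • f i) ≤ b} := by
  have hc : Continuous fun y : Fin n → ℝ => ∑ i, y i • f i := by fun_prop
  exact (measurableSet_le ((continuous_enorm.comp hc).measurable.pow_const 2)
    measurable_const).inter (measurableSet_le
      (lowerSemicontinuous_quartic.measurable.comp hc.measurable) measurable_const)

/-- Markov's inequality for the squared L² norm and for the quartic functional, each failing with
probability at most 1/4. The added 1 keeps the second threshold nonzero; neither threshold depends
on n. -/
theorem half_le_measure_tail (hh : IsDirichletOrthonormal h) {l : ℝ≥0∞} (hl : l ≠ 0) (hl' : l ≠ ⊤)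
    {m : ℕ} (hm : ∑' i, ‖h (m + i)‖ₑ ^ 2 ≤ l / 4) (n : ℕ) :
    1 / 2 ≤ stdGaussianPi n {z | ‖∑ i : Fin n, z i • h (m + i)‖ₑ ^ 2 ≤ l ∧
      quartic (∑ i : Fin n, z i • h (m + i)) ≤ 4 * (quarticBound + 1)} := by
  set B := {z : Fin n → ℝ | ‖∑ i : Fin n, z i • h (m + i)‖ₑ ^ 2 ≤ l ∧
      quartic (∑ i : Fin n, z i • h (m + i)) ≤ 4 * (quarticBound + 1)} with hB
  have hc : Continuous fun y : Fin n → ℝ => ∑ i, y i • h (m + i) := by fun_prop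
  have h1 : stdGaussianPi n {z | l ≤ ‖∑ i : Fin n, z i • h (m + i)‖ₑ ^ 2} ≤ 1 / 4 := by
    have e := lintegral_enorm_add_sum_sq (0 : L2Disc) fun i : Fin n => h (m + i)
    simp only [zero_add, enorm_zero, ne_eq, OfNat.ofNat_ne_zero, not_false_eq_true,
      zero_pow] at e
    have hsum : ∑ i : Fin n, ‖h (m + i)‖ₑ ^ 2 ≤ l / 4 := by
      rw [Fin.sum_univ_eq_sum_range fun i => ‖h (m + i)‖ₑ ^ 2]
      exact (ENNReal.sum_le_tsum _).trans hm
    refine (meas_ge_le_lintegral_div ((continuous_enorm.comp hc).measurable.pow_const 2).aemeasurable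
      hl hl').trans ?_
    refine ENNReal.div_le_of_le_mul ?_
    refine (e.trans_le hsum).trans_eq ?_
    rw [one_div, ENNReal.div_eq_inv_mul]
  have h2 : stdGaussianPi n {z | 4 * (quarticBound + 1) ≤ quartic (∑ i : Fin n, z i • h (m + i))}
      ≤ 1 / 4 := by
    have hqt := quarticBound_ne_top
    refine (meas_ge_le_lintegral_div
      (lowerSemicontinuous_quartic.measurable.comp hc.measurable).aemeasurable
      (by simp) (by finiteness)).trans ?_
    refine ENNReal.div_le_of_le_mul ((hh.lintegral_quartic_le m n).trans ?_)
    rw [← mul_assoc, one_div, ENNReal.inv_mul_cancel (by simp) (by simp), one_mul]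
    exact le_self_add
  have h3 : Bᶜ ⊆ {z | l ≤ ‖∑ i : Fin n, z i • h (m + i)‖ₑ ^ 2} ∪
      {z | 4 * (quarticBound + 1) ≤ quartic (∑ i : Fin n, z i • h (m + i))} := by
    intro z hz
    by_contra hcon
    simp only [Set.mem_union, Set.mem_ofPred_eq, not_or, not_le] at hcon
    exact hz ⟨hcon.1.le, hcon.2.le⟩
  have h4 : stdGaussianPi n Bᶜ ≤ 1 / 2 := by
    refine (measure_mono h3).trans ((measure_union_le _ _).trans ((add_le_add h1 h2).trans_eq ?_))
    rw [← ENNReal.toReal_eq_toReal_iff' (by finiteness) (by finiteness),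
      ENNReal.toReal_add (by finiteness) (by finiteness)]
    norm_num
  have h5 : (1 : ℝ≥0∞) ≤ stdGaussianPi n B + 1 / 2 := by
    refine le_trans ?_ (add_le_add le_rfl h4)
    rw [← measure_univ (μ := stdGaussianPi n), ← Set.union_compl_self B]
    exact measure_union_le _ _
  refine (ENNReal.add_le_add_iff_right (a := 1 / 2) (by finiteness)).1 ?_
  rwa [ENNReal.add_halves]

/-- Small balls of `L²(𝔻)`, intersected with a large ball of `L⁴(𝔻)`, have probability bounded
below along the partial sums of the Gaussian series. -/
theorem exists_smallBall (hh : IsDirichletOrthonormal h) {ε : ℝ} (hε : 0 < ε) :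
    ∃ (m : ℕ) (M : ℝ) (p : ℝ≥0∞), 0 ≤ M ∧ p ≠ 0 ∧ ∀ n,
      p ≤ stdGaussianPi (m + n) {y | ‖∑ i, y i • h i‖ₑ ^ 2 ≤ ENNReal.ofReal (ε ^ 2) ∧
        quartic (∑ i, y i • h i) ≤ ENNReal.ofReal M} := by
  set l : ℝ≥0∞ := ENNReal.ofReal ((ε / 2) ^ 2) with hl
  have hl0 : l ≠ 0 := by
    rw [hl, ne_eq, ENNReal.ofReal_eq_zero, not_le]
    positivity
  have htail : Tendsto (fun m => ∑' i, ‖h (m + i)‖ₑ ^ 2) atTop (𝓝 0) := by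
    simpa [add_comm] using ENNReal.tendsto_sum_nat_add (fun i => ‖h i‖ₑ ^ 2) hh.tsum_enorm_sq_ne_top
  -- The cutoff m between low and high modes makes the remaining trace at most a quarter of (ε/2)².
  obtain ⟨m, hm⟩ := (htail.eventually_le_const
    (ENNReal.div_pos hl0 (by simp : (4 : ℝ≥0∞) ≠ ⊤))).exists
  set R : ℝ := ∑ i : Fin m, ‖h i‖ with hR
  have hR0 : 0 ≤ R := Finset.sum_nonneg fun _ _ => norm_nonneg _
  -- The half-width of the cube keeps the low modes within ε/2 in L²; R + 1 avoids dividing by zero.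
  set η : ℝ := ε / 2 / (R + 1) with hη
  have hη0 : 0 < η := by positivity
  -- Ladyzhenskaya's bound for the low modes, whose energy on the cube is at most mη². The factor 8
  -- in M' comes from `quartic_add_le`.
  set M₀ : ℝ≥0∞ := ladyzhenskayaConst * (l * ENNReal.ofReal (∑ _i : Fin m, η ^ 2)) with hM₀
  set M' : ℝ≥0∞ := 8 * (M₀ + 4 * (quarticBound + 1)) with hM'
  have hM't : M' ≠ ⊤ := by
    have := quarticBound_ne_top
    have : l ≠ ⊤ := ENNReal.ofReal_ne_top
    finiteness
  refine ⟨m, M'.toReal, stdGaussianPi m (Set.pi Set.univ fun _ => Set.Icc (-η) η) * (1 / 2),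
    ENNReal.toReal_nonneg, mul_ne_zero (stdGaussianPi_cube_pos m hη0) (by simp), fun n => ?_⟩
  refine le_trans (mul_le_mul_right (hh.half_le_measure_tail hl0 ENNReal.ofReal_ne_top hm n) _)
    (stdGaussianPi_mul_le (MeasurableSet.univ_pi fun _ => measurableSet_Icc)
      (measurableSet_ball_quartic _ _ _) fun y hyA hyB => ?_)
  obtain ⟨hB1, hB2⟩ := hyB
  have hy : ∀ i : Fin m, |y (Fin.castAdd n i)| ≤ η := fun i => abs_le.2 (hyA i (Set.mem_univ i))
  set s₁ := ∑ i : Fin m, y (Fin.castAdd n i) • h i with hs₁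
  set s₂ := ∑ i : Fin n, y (Fin.natAdd m i) • h (m + i) with hs₂
  have hs : ∑ i, y i • h i = s₁ + s₂ := by
    rw [Fin.sum_univ_add]
    rfl
  have hn₁ : ‖s₁‖ ≤ ε / 2 := by
    calc ‖s₁‖ ≤ ∑ i : Fin m, η * ‖h i‖ := by
          refine norm_sum_le_of_le _ fun i _ => ?_
          rw [norm_smul, Real.norm_eq_abs]
          gcongr
          exact hy i
      _ = η * R := by rw [hR, Finset.mul_sum]
      _ ≤ η * (R + 1) := by gcongr; linarith
      _ = ε / 2 := by rw [hη]; field_simp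
  have hn₁' : ‖s₁‖ₑ ^ 2 ≤ l := by
    rw [enorm_pow_eq_ofReal]
    exact ENNReal.ofReal_le_ofReal (pow_le_pow_left₀ (norm_nonneg _) hn₁ 2)
  have hn₂ : ‖s₂‖ ≤ ε / 2 := by
    rw [enorm_pow_eq_ofReal, hl, ENNReal.ofReal_le_ofReal_iff (by positivity)] at hB1
    exact (pow_le_pow_iff_left₀ (norm_nonneg _) (by positivity) two_ne_zero).1 hB1
  have hq₁ : quartic s₁ ≤ M₀ := by
    refine (hh.quartic_fin_sum_le _).trans ?_
    have hsq : ∑ i : Fin m, y (Fin.castAdd n i) ^ 2 ≤ ∑ _i : Fin m, η ^ 2 :=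
      Finset.sum_le_sum fun i _ => sq_le_sq' (abs_le.1 (hy i)).1 (abs_le.1 (hy i)).2
    rw [hM₀]
    gcongr
  refine ⟨?_, ?_⟩
  · rw [hs, enorm_pow_eq_ofReal]
    refine ENNReal.ofReal_le_ofReal (pow_le_pow_left₀ (norm_nonneg _) ?_ 2)
    exact (norm_add_le _ _).trans (by linarith)
  · rw [hs, ENNReal.ofReal_toReal hM't]
    refine (quartic_add_le _ _).trans ?_
    rw [hM']
    gcongr

/-- Uniform exponential integrability of the quartic functional along the partial sums. -/
theorem lintegral_quarticExp_partialSum_le (hh : IsDirichletOrthonormal h) {C ε M : ℝ} (hC : 0 < C)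
    (hε : 0 < ε) (hCε : 288 * C * ladyzhenskayaConst * ε ^ 2 ≤ 1) (hM : 0 ≤ M) (N : ℕ) :
    (∫⁻ x, Set.indicator {x : Fin N → ℝ | ‖∑ i, x i • h i‖ ≤ 2 * ε}
        (fun x => quarticExp C (∑ i, x i • h i)) x ∂stdGaussianPi N) *
      (ENNReal.ofReal (Real.exp (-(C * (8 * M)))) *
        stdGaussianPi N {y | ‖∑ i, y i • h i‖ₑ ^ 2 ≤ ENNReal.ofReal (ε ^ 2) ∧
        quartic (∑ i, y i • h i) ≤ ENNReal.ofReal M}) ≤ 1 := by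
  set E := {y : Fin N → ℝ | ‖∑ i, y i • h i‖ₑ ^ 2 ≤ ENNReal.ofReal (ε ^ 2) ∧
        quartic (∑ i, y i • h i) ≤ ENNReal.ofReal M} with hE
  set K : ℝ := (ladyzhenskayaConst : ℝ) with hK
  have hK0 : 0 ≤ K := ladyzhenskayaConst.coe_nonneg
  have hEm : MeasurableSet E := measurableSet_ball_quartic _ _ _
  have hc : Continuous fun y : Fin N → ℝ => ∑ i, y i • h i := by fun_prop
  rw [← setLIntegral_const, ← lintegral_indicator hEm]
  -- Property (τ) with u the truncated exponential and v = exp(−8CM) on E; only x in the ball and y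
  -- in E need checking.
  refine stdGaussianPi_lintegral_mul_le
    (((lowerSemicontinuous_quarticExp C).measurable.comp hc.measurable).indicator
      (isClosed_le hc.norm continuous_const).measurableSet)
    (measurable_const.indicator hEm) fun x y => ?_
  by_cases hx : x ∈ {x : Fin N → ℝ | ‖∑ i, x i • h i‖ ≤ 2 * ε}
  swap
  · rw [Set.indicator_of_notMem hx, zero_mul]
    exact bot_le
  by_cases hy : y ∈ E
  swap
  · rw [Set.indicator_of_notMem hy, mul_zero]
    exact bot_le
  rw [Set.indicator_of_mem hx, Set.indicator_of_mem hy]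
  obtain ⟨hy1, hy2⟩ := hy
  have hx' : ‖∑ i, x i • h i‖ ≤ 2 * ε := hx
  have hy1' : ‖∑ i, y i • h i‖ ≤ ε := by
    rw [enorm_pow_eq_ofReal, ENNReal.ofReal_le_ofReal_iff (by positivity)] at hy1
    exact (pow_le_pow_iff_left₀ (norm_nonneg _) hε.le two_ne_zero).1 hy1
  set d : ℝ := ∑ i, (x i - y i) ^ 2 with hd
  have hd0 : 0 ≤ d := Finset.sum_nonneg fun _ _ => sq_nonneg _
  have hsub : ∑ i, (x i - y i) • h i = ∑ i, x i • h i - ∑ i, y i • h i := by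
    simp only [sub_smul, Finset.sum_sub_distrib]
  have hn : ‖∑ i, (x i - y i) • h i‖ ≤ 3 * ε := by
    rw [hsub]
    exact (norm_sub_le _ _).trans (by linarith)
  have hq : quartic (∑ i, x i • h i) ≤ ENNReal.ofReal (8 * (M + K * ((3 * ε) ^ 2 * d))) := by
    have e : ∑ i, x i • h i = ∑ i, y i • h i + ∑ i, (x i - y i) • h i := by
      rw [hsub, add_sub_cancel]
    rw [e, ENNReal.ofReal_mul (by norm_num), ENNReal.ofReal_add hM (by positivity),
      ENNReal.ofReal_mul hK0, ENNReal.ofReal_mul (by positivity), ENNReal.ofReal_ofNat, hK,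
      ENNReal.ofReal_coe_nnreal]
    refine (quartic_add_le _ _).trans ?_
    gcongr
    refine (hh.quartic_fin_sum_le fun i => x i - y i).trans ?_
    gcongr
    rw [enorm_pow_eq_ofReal]
    exact ENNReal.ofReal_le_ofReal (pow_le_pow_left₀ (norm_nonneg _) hn 2)
  calc quarticExp C (∑ i, x i • h i) * ENNReal.ofReal (Real.exp (-(C * (8 * M))))
      ≤ ENNReal.ofReal (Real.exp (C * (8 * (M + K * ((3 * ε) ^ 2 * d))))) *
          ENNReal.ofReal (Real.exp (-(C * (8 * M)))) := by
        gcongr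
        exact quarticExp_le hC.le (by positivity) hq
    _ ≤ ENNReal.ofReal (Real.exp (d / 4)) := by
        rw [← ENNReal.ofReal_mul (Real.exp_pos _).le, ← Real.exp_add]
        refine ENNReal.ofReal_le_ofReal (Real.exp_le_exp.2 ?_)
        -- After the terms in M cancel, the claim is 72CKε²d ≤ d/4, which is the hypothesis with 288
        -- = 4·8·9.
        nlinarith [mul_le_mul_of_nonneg_right hCε hd0]

/-- Exponential integrability of the quartic functional of the Gaussian series, on small balls
of `L²(𝔻)`. -/
theorem setLIntegral_quarticExp_lt_top (hh : IsDirichletOrthonormal h) {C ε : ℝ} (hC : 0 < C)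
    (hε : 0 < ε) (hCε : 288 * C * ladyzhenskayaConst * ε ^ 2 ≤ 1) :
    ∫⁻ v in {v : L2Disc | ‖v‖ ≤ ε}, quarticExp C v ∂freeGaussian h < ⊤ := by
  obtain ⟨m, M, p, hM, hp, hsmall⟩ := hh.exists_smallBall hε
  set D := ENNReal.ofReal (Real.exp (-(C * (8 * M)))) with hD
  have hD0 : D ≠ 0 := by
    rw [hD, ne_eq, ENNReal.ofReal_eq_zero, not_le]
    exact Real.exp_pos _
  -- Doubling the radius leaves room: if the limit has norm at most ε, the partial sums eventually
  -- have norm below 2ε, even when the limit lies on the sphere.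
  set F : L2Disc → ℝ≥0∞ := Set.indicator {v : L2Disc | ‖v‖ ≤ 2 * ε} (quarticExp C) with hF
  have hFm : Measurable F := (lowerSemicontinuous_quarticExp C).measurable.indicator
    (isClosed_le continuous_norm continuous_const).measurableSet
  have hsum : ∀ n, Measurable fun g : ℕ → ℝ => ∑ i ∈ Finset.range n, g i • h i := fun n =>
    (Finset.stronglyMeasurable_fun_sum _ fun i _ =>
      (measurable_pi_apply i).stronglyMeasurable.smul_const (h i)).measurable
  have hbound : ∀ n, ∫⁻ g, F (∑ i ∈ Finset.range (m + n), g i • h i) ∂gaussianSequence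
      ≤ (D * p)⁻¹ := by
    intro n
    have hc : Continuous fun y : Fin (m + n) → ℝ => ∑ i, y i • h i := by fun_prop
    have e : ∫⁻ g, F (∑ i ∈ Finset.range (m + n), g i • h i) ∂gaussianSequence
        = ∫⁻ x, F (∑ i : Fin (m + n), x i • h i) ∂stdGaussianPi (m + n) := by
      rw [← map_gaussianSequence 0 (m + n)]
      refine Eq.trans ?_
        (lintegral_map (hFm.comp hc.measurable) (measurable_shift 0 (m + n))).symm
      simp [Finset.sum_range]
    rw [e, ENNReal.le_inv_iff_mul_le]
    refine le_trans ?_ (hh.lintegral_quarticExp_partialSum_le hC hε hCε hM (m + n))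
    exact mul_le_mul_right (mul_le_mul_right (hsmall n) _) _
  have hlim : ∀ᵐ g ∂gaussianSequence,
      Set.indicator {v : L2Disc | ‖v‖ ≤ ε} (quarticExp C) (gaussianSeries h g)
        ≤ liminf (fun n => F (∑ i ∈ Finset.range (m + n), g i • h i)) atTop := by
    filter_upwards [ae_exists_tendsto_gaussian_sum hh.tsum_enorm_sq_ne_top] with g hg
    have ht : Tendsto (fun n => ∑ i ∈ Finset.range (m + n), g i • h i) atTop
        (𝓝 (gaussianSeries h g)) := by
      have := (tendsto_nhds_limUnder hg).comp (tendsto_add_atTop_nat m)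
      refine this.congr fun n => ?_
      simp [add_comm]
    set v := gaussianSeries h g
    refine Set.indicator_apply_le' (fun hv => ?_) fun _ => bot_le
    have hv' : ‖v‖ < 2 * ε := lt_of_le_of_lt hv.out (by linarith)
    calc quarticExp C v ≤ liminf (quarticExp C) (𝓝 v) :=
          lowerSemicontinuousAt_iff_le_liminf.1 (lowerSemicontinuous_quarticExp C v)
      _ ≤ liminf (quarticExp C) (map (fun n => ∑ i ∈ Finset.range (m + n), g i • h i) atTop) :=
          liminf_le_liminf_of_le ht
      _ = liminf (fun n => quarticExp C (∑ i ∈ Finset.range (m + n), g i • h i)) atTop := rfl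
      _ = _ := by
          refine liminf_congr ?_
          filter_upwards [ht.norm.eventually_lt_const hv'] with n hn
          rw [hF, Set.indicator_of_mem]
          exact hn.le
  calc ∫⁻ v in {v : L2Disc | ‖v‖ ≤ ε}, quarticExp C v ∂freeGaussian h
      = ∫⁻ v, Set.indicator {v : L2Disc | ‖v‖ ≤ ε} (quarticExp C) v ∂freeGaussian h :=
        (lintegral_indicator (isClosed_le continuous_norm continuous_const).measurableSet _).symm
    _ ≤ ∫⁻ g, Set.indicator {v : L2Disc | ‖v‖ ≤ ε} (quarticExp C) (gaussianSeries h g)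
          ∂gaussianSequence := lintegral_map_le _ _
    _ ≤ ∫⁻ g, liminf (fun n => F (∑ i ∈ Finset.range (m + n), g i • h i)) atTop
          ∂gaussianSequence := lintegral_mono_ae hlim
    _ ≤ liminf (fun n => ∫⁻ g, F (∑ i ∈ Finset.range (m + n), g i • h i) ∂gaussianSequence) atTop :=
        lintegral_liminf_le fun n => hFm.comp (hsum (m + n))
    _ ≤ (D * p)⁻¹ := by
        refine liminf_le_of_le (by isBoundedDefault) fun b hb => ?_
        obtain ⟨n, hn⟩ := hb.exists
        exact hn.trans (hbound n)
    _ < ⊤ := ENNReal.inv_lt_top.2 (ENNReal.mul_pos hD0 hp)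

end IsDirichletOrthonormal

end

end RadialNLS

/-! ### The main theorem -/

theorem lemma5p5 (Q : RadialNLS.Plane → ℝ) (hQ : RadialNLS.IsGroundState Q)
    (C : ℝ) (hC : 0 < C) :
    ∃ ε₀ : ℝ, 0 < ε₀ ∧ ∀ ε : ℝ, 0 < ε → ε ≤ ε₀ → ∀ δ : ℝ, 0 < δ →
      ∀ h : ℕ → RadialNLS.L2Disc,
        RadialNLS.IsDirichletBasis (RadialNLS.normalSpace Q δ) h →
        ∫⁻ v in {v : RadialNLS.L2Disc | ‖v‖ ≤ ε},
          RadialNLS.quarticExp C v ∂(RadialNLS.freeGaussian h) < ⊤ := by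
  have hK : (0 : ℝ) ≤ RadialNLS.ladyzhenskayaConst := NNReal.coe_nonneg _
  set A : ℝ := 288 * C * RadialNLS.ladyzhenskayaConst with hA
  have hA0 : 0 ≤ A := by positivity
  -- From ε(A + 1) ≤ 1 both ε ≤ 1 and Aε ≤ 1 follow, hence Aε² ≤ 1.
  refine ⟨1 / (A + 1), by positivity, fun ε hε hε₀ δ _ h hh =>
    hh.isDirichletOrthonormal.setLIntegral_quarticExp_lt_top hC hε ?_⟩
  rw [← hA]
  rw [le_div_iff₀ (by positivity)] at hε₀
  have h1 : ε ≤ 1 := by nlinarith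
  nlinarith [mul_nonneg hA0 hε.le]
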